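/- Let $G=(V,w,m)$ be a weighted, connected, locally finite graph: $V\neq\emptyset$, $w\colon V\times V\to[0,\infty)$ is symmetric, $m\colon V\to(0,\infty)$, $x\sim y$ means $w_{xy}>0$, every vertex has finitely many neighbours, and any two vertices are joined by a path. For $f,g\colon V\to\mathbb R$ put $$\Delta f(x)=\frac1{m(x)}\sum_{y}w_{xy}(f(y)-f(x)),\quad \Gamma(f,g)=\tfrac12\big(\Delta(fg)-f\Delta g-g\Delta f\big),\quad \Gamma_2(f,g)=\tfrac12\big(\Delta\Gamma(f,g)-\Gamma(f,\Delta g)-\Gamma(g,\Delta f)\big),$$ $\Gamma f=\Gamma(f,f)$ and $\Gamma_2f=\Gamma_2(f,f)$. For $K\in\mathbb R$ and $N\in(0,\infty]$, the condition $CD(K,N,x)$ says that $\Gamma_2f(x)\ge K\,\Gamma f(x)+\frac1N(\Delta f(x))^2$ for all $f\colon V\to\mathbb R$ (with $\frac1\infty=0$), and $K_{G,x}(N)=\sup\{K\in\mathbb R: CD(K,N,x)\}\in[-\infty,\infty]$. For finite $W\subset V$ let $\Delta_W$ be the Dirichlet Laplacian on $W$ (extend functions on $W$ by zero, apply $\Delta$,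 restrict to $W$) and let $p_W(t,x,y)$, $t\ge 0$, be the $(x,y)$ entry of the matrix $e^{t\Delta_W}$ if $x,y\in W$, and $0$ otherwise. Let $p(t,x,y)=\sup_W p_W(t,x,y)$ be the minimal heat kernel, and $P_tf(x)=\sum_{y\in V}p(t,x,y)f(y)$ the heat semigroup on bounded functions. Assume that $G$ is complete, i.e. there is a nondecreasing sequence of finitely supported functions $\eta_k$, $k\ge1$, with $\eta_k\to1$ pointwise and $\Gamma\eta_k\le\frac1k$, and that $m$ is non-degenerate, i.e. $\inf_{x\in V}m(x)>0$. Let $N\in(0,\infty]$, $V_0=\{x\in V: K_{G,x}(N)\le0\}$, $K>0$ and $K_0\ge0$, and suppose that $CD(-K_0,N,x)$ holds for all $x\in V$ and $CD(K,N,x)$ holds for all $x\in V\setminus V_0$. Then for every bounded $f\colon V\to\mathbb R$ with $\Gamma f$ bounded, every $T\ge0$ and every $x\in V$, the sums and the integral below converge and $$\Gamma(P_Tf)(x)\le e^{-2KT}P_T(\Gamma f)(x)-\frac{1-e^{-2KT}}{KN}\,(\Delta P_Tf(x))^2+2(K_0+K)\,\|\Gamma f\|_\infty\,e^{2K_0T}\int_0^Te^{-2(K+K_0)s}\,P_s1_{V_0}(x)\,ds.$$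 -/

import Mathlib

open scoped ENNReal

/-- A weighted, connected, locally finite graph on the vertex set `V`, with edge measure `w` and
vertex measure `m`; the vertices `x` and `y` are neighbours when `0 < w x y`. -/
structure WeightedGraph (V : Type*) where
  w : V → V → ℝ
  m : V → ℝ
  w_nonneg : ∀ x y, 0 ≤ w x y
  w_symm : ∀ x y, w x y = w y x
  m_pos : ∀ x, 0 < m x
  locallyFinite : ∀ x, {y | 0 < w x y}.Finite
  nonempty : Nonempty V
  connected : ∀ x y, Relation.ReflTransGen (fun a b => 0 < w a b) x y

namespace WeightedGraph

noncomputable section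

variable {V : Type*} (G : WeightedGraph V)

/-- The finite set of neighbours of `x`. -/
def neighbors (x : V) : Finset V := (G.locallyFinite x).toFinset

/-- The Laplacian `Δ f (x) = (1 / m x) ∑_y w x y (f y - f x)`. -/
def laplacian (f : V → ℝ) (x : V) : ℝ :=
  (1 / G.m x) * ∑ y ∈ G.neighbors x, G.w x y * (f y - f x)

/-- The carré du champ operator, `Γ(f, g) = (Δ(f g) - f Δ g - g Δ f) / 2`. -/
def gammaBilin (f g : V → ℝ) (x : V) : ℝ :=
  (1 / 2) * (G.laplacian (f * g) x - f x * G.laplacian g x - g x * G.laplacian f x)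

/-- `Γ f = Γ(f, f)`. -/
def gamma (f : V → ℝ) : V → ℝ := G.gammaBilin f f

/-- `Γ₂(f, g) = (Δ Γ(f, g) - Γ(f, Δ g) - Γ(g, Δ f)) / 2`. -/
def gamma2Bilin (f g : V → ℝ) (x : V) : ℝ :=
  (1 / 2) * (G.laplacian (G.gammaBilin f g) x - G.gammaBilin f (G.laplacian g) x
    - G.gammaBilin g (G.laplacian f) x)

/-- `Γ₂ f = Γ₂(f, f)`. -/
def gamma2 (f : V → ℝ) : V → ℝ := G.gamma2Bilin f f

/-- The pointwise curvature dimension condition `CD(K, N, x)` for `N ∈ (0, ∞]`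
(with `1 / N = 0` for `N = ∞`). -/
def CD (K : ℝ) (N : ℝ≥0∞) (x : V) : Prop :=
  ∀ f : V → ℝ, K * G.gamma f x + (N⁻¹).toReal * (G.laplacian f x) ^ 2 ≤ G.gamma2 f x

/-- `K_{G,x}(N) = sup {K | CD(K, N, x)}`, a supremum in the extended reals. -/
def curvature (N : ℝ≥0∞) (x : V) : EReal :=
  sSup ((fun K : ℝ => (K : EReal)) '' {K : ℝ | G.CD K N x})

/-- The set `V₀` of the vertices with nonpositive curvature. -/
def nonposCurvatureSet (N : ℝ≥0∞) : Set V := {x | G.curvature N x ≤ 0}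

/-- Completeness: there are finitely supported functions `η₁ ≤ η₂ ≤ …` converging pointwise to the
constant `1`, with `Γ(η_k) ≤ 1 / k` (here `η k` is the function of index `k + 1`). -/
def IsComplete : Prop :=
  ∃ η : ℕ → V → ℝ, Monotone η ∧ (∀ k, (Function.support (η k)).Finite) ∧
    (∀ x, Filter.Tendsto (fun k => η k x) Filter.atTop (nhds 1)) ∧
    ∀ k x, G.gamma (η k) x ≤ 1 / ((k : ℝ) + 1)

/-- The vertex measure is non-degenerate: `inf m > 0`. -/
def NonDegenerate : Prop := 0 < ⨅ x, G.m x

open Classical in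
/-- The matrix of the Dirichlet Laplacian on a finite vertex set `W`: functions on `W` are extended
by zero to `V`, the Laplacian is applied, and the result is restricted to `W`. -/
def dirichletMatrix (W : Finset V) : Matrix W W ℝ :=
  Matrix.of fun x y => G.laplacian (Pi.single (y : V) (1 : ℝ)) (x : V)

open Classical in
/-- The Dirichlet heat kernel on a finite vertex set `W`, extended by zero to `V`, as a kernel with
respect to the counting measure. -/
def dirichletHeatKernel (W : Finset V) (t : ℝ) (x y : V) : ℝ :=
  if h : x ∈ W ∧ y ∈ W then NormedSpace.exp (t • G.dirichletMatrix W) ⟨x, h.1⟩ ⟨y, h.2⟩ else 0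

/-- The minimal heat kernel, obtained by exhaustion: for `t ≥ 0` the Dirichlet heat kernels take
values in `[0, 1]` and increase with `W`, so that their limit is their supremum. -/
def heatKernel (t : ℝ) (x y : V) : ℝ := ⨆ W : Finset V, G.dirichletHeatKernel W t x y

/-- The heat semigroup on bounded functions, `P_t f (x) = ∑_y p(t, x, y) f(y)`. -/
def heatSemigroup (t : ℝ) (f : V → ℝ) (x : V) : ℝ := ∑' y, G.heatKernel t x y * f y

end

end WeightedGraph

namespace WeightedGraph

open Set Filter Topology MeasureTheory

variable {V : Type*} (G : WeightedGraph V)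

/-! Take $f$ finitely supported and put $u_s=P_sf$, $v_s=\Delta u_s=P_s\Delta f$, $A$ a bound for
$\Gamma f$, and $J_s=\int_0^s e^{-2(K+K_0)r}P_r1_{V_0}\,dr$. Moving everything to one side, the
claim is $F_T\le0$ for $$F_s=\Gamma u_s-e^{-2Ks}P_s\Gamma
f+\tfrac{1-e^{-2Ks}}{KN}v_s^2-2(K_0+K)Ae^{2K_0s}J_s.$$ Here $F_0=0$, and the curvature conditions
give $\partial_sF\le\Delta F-2KF$. Off $V_0$ this uses $CD(K,N)$; on $V_0$, $CD(-K_0,N)$ leaves the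
error $2(K_0+K)\Gamma u_s\le2(K_0+K)Ae^{2K_0s}$, which the source $1_{V_0}$ in the equation of $J$
absorbs. So $F$ is a subsolution of the heat equation wherever it is positive, and a comparison
principle ends the argument.

Comparison (`IsCutoff.nonpos_of_subsolution`) holds on a complete graph if $F^+$ is bounded in
$\ell^2(m)$ uniformly in time: test with $\eta_k^2F^+$, and the Caccioppoli inequality makes the
cutoff error $O(1/k)$. For the $\ell^2$ bound, $F^+\le\Gamma u+\frac1{KN}v^2$; both terms are in
$\ell^1(m)$, by the energy estimate `IsCutoff.sum_gamma_le` and by contraction, and $\inf m>0$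
upgrades $\ell^1$ to $\ell^2$. The bound $\Gamma u_s\le e^{2K_0s}A$ is a simpler instance of the
same comparison.

A bounded $f$ is approximated by $\eta_kf$, with $\limsup_k\sup\Gamma(\eta_kf)\le\|\Gamma
f\|_\infty$ from `gamma_mul_le`. -/

/-! ### Pointwise calculus of $\Delta$ and $\Gamma$ -/

theorem mem_neighbors {x y : V} : y ∈ G.neighbors x ↔ 0 < G.w x y := by
  simp [neighbors]

theorem w_eq_zero {x y : V} (h : y ∉ G.neighbors x) : G.w x y = 0 :=
  le_antisymm (not_lt.1 fun h' => h (G.mem_neighbors.2 h')) (G.w_nonneg x y)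

theorem sum_neighbors {x : V} {S : Finset V} (hS : G.neighbors x ⊆ S) (F : V → ℝ) :
    ∑ y ∈ G.neighbors x, G.w x y * F y = ∑ y ∈ S, G.w x y * F y :=
  Finset.sum_subset hS fun y _ hy => by rw [G.w_eq_zero hy, zero_mul]

theorem m_mul_laplacian (f : V → ℝ) {x : V} {S : Finset V} (hS : G.neighbors x ⊆ S) :
    G.m x * G.laplacian f x = ∑ y ∈ S, G.w x y * (f y - f x) := by
  rw [laplacian, G.sum_neighbors hS (fun y => f y - f x), ← mul_assoc,
    mul_one_div_cancel (G.m_pos x).ne', one_mul]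

theorem gammaBilin_eq (f g : V → ℝ) (x : V) :
    G.gammaBilin f g x =
      1 / (2 * G.m x) * ∑ y ∈ G.neighbors x, G.w x y * ((f y - f x) * (g y - g x)) := by
  have h : ∑ y ∈ G.neighbors x, G.w x y * ((f y - f x) * (g y - g x)) =
      ∑ y ∈ G.neighbors x, G.w x y * ((f * g) y - (f * g) x)
        - f x * ∑ y ∈ G.neighbors x, G.w x y * (g y - g x)
        - g x * ∑ y ∈ G.neighbors x, G.w x y * (f y - f x) := by
    simp only [Finset.mul_sum, ← Finset.sum_sub_distrib, Pi.mul_apply]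
    exact Finset.sum_congr rfl fun y _ => by ring
  have := (G.m_pos x).ne'
  rw [h, gammaBilin, laplacian, laplacian, laplacian]
  field_simp

theorem m_mul_gamma (f : V → ℝ) {x : V} {S : Finset V} (hS : G.neighbors x ⊆ S) :
    G.m x * G.gamma f x = 1 / 2 * ∑ y ∈ S, G.w x y * (f y - f x) ^ 2 := by
  have := (G.m_pos x).ne'
  rw [gamma, gammaBilin_eq, ← G.sum_neighbors hS (fun y => (f y - f x) ^ 2)]
  simp only [← pow_two]
  field_simp

theorem gamma_nonneg (f : V → ℝ) (x : V) : 0 ≤ G.gamma f x := by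
  rw [gamma, gammaBilin_eq]
  have := G.m_pos x
  exact mul_nonneg (by positivity) (Finset.sum_nonneg fun y _ =>
    mul_nonneg (G.w_nonneg x y) (mul_self_nonneg _))

theorem gamma_le_gamma {f g : V → ℝ} {x : V} (h : ∀ y, (f y - f x) ^ 2 ≤ (g y - g x) ^ 2) :
    G.gamma f x ≤ G.gamma g x := by
  refine le_of_mul_le_mul_left ?_ (G.m_pos x)
  rw [G.m_mul_gamma f subset_rfl, G.m_mul_gamma g subset_rfl]
  exact mul_le_mul_of_nonneg_left (Finset.sum_le_sum fun y _ =>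
    mul_le_mul_of_nonneg_left (h y) (G.w_nonneg x y)) (by norm_num)

theorem laplacian_tendsto {ι : Type*} {l : Filter ι} {f : ι → V → ℝ} {g : V → ℝ}
    (h : ∀ x, Tendsto (fun i => f i x) l (𝓝 (g x))) (x : V) :
    Tendsto (fun i => G.laplacian (f i) x) l (𝓝 (G.laplacian g x)) :=
  (tendsto_finsetSum _ fun y _ => ((h y).sub (h x)).const_mul _).const_mul _

theorem gamma_tendsto {ι : Type*} {l : Filter ι} {f : ι → V → ℝ} {g : V → ℝ}
    (h : ∀ x, Tendsto (fun i => f i x) l (𝓝 (g x))) (x : V) :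
    Tendsto (fun i => G.gamma (f i) x) l (𝓝 (G.gamma g x)) := by
  simp only [gamma, gammaBilin_eq]
  exact (tendsto_finsetSum _ fun y _ => (((h y).sub (h x)).mul ((h y).sub (h x))).const_mul _).const_mul _

theorem gamma_hasDerivAt {u : ℝ → V → ℝ} {u' : V → ℝ} {t : ℝ}
    (h : ∀ x, HasDerivAt (fun s => u s x) (u' x) t) (x : V) :
    HasDerivAt (fun s => G.gamma (u s) x) (2 * G.gammaBilin (u t) u' x) t := by
  simp only [gamma, gammaBilin_eq]
  have := (HasDerivAt.fun_sum fun y (_ : y ∈ G.neighbors x) =>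
    (((h y).sub (h x)).mul ((h y).sub (h x))).const_mul (G.w x y)).const_mul (1 / (2 * G.m x))
  refine this.congr_deriv ?_
  simp only [Finset.mul_sum, Pi.sub_apply]
  exact Finset.sum_congr rfl fun y _ => by ring

theorem laplacian_add (f g : V → ℝ) (x : V) :
    G.laplacian (fun y => f y + g y) x = G.laplacian f x + G.laplacian g x := by
  simp only [laplacian, ← mul_add, ← Finset.sum_add_distrib]
  exact congrArg _ (Finset.sum_congr rfl fun y _ => by ring)

theorem laplacian_const_mul (c : ℝ) (f : V → ℝ) (x : V) :
    G.laplacian (fun y => c * f y) x = c * G.laplacian f x := by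
  simp only [laplacian, Finset.mul_sum]
  exact Finset.sum_congr rfl fun y _ => by ring

theorem laplacian_sub_const (f : V → ℝ) (c : ℝ) (x : V) :
    G.laplacian (fun y => f y - c) x = G.laplacian f x := by
  simp [laplacian]

theorem laplacian_sq (f : V → ℝ) (x : V) :
    G.laplacian (fun y => f y ^ 2) x = 2 * f x * G.laplacian f x + 2 * G.gamma f x := by
  have h : (fun y => f y ^ 2) = f * f := funext fun y => pow_two _
  rw [gamma, gammaBilin, h]
  ring

/-! ### Summation by parts over finite sets -/

/-- For functions vanishing off $W$, such an $S$ replaces $V$: edge sums become finite symmetric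
double sums over $S$. -/
theorem exists_hull (W : Finset V) : ∃ S : Finset V, W ⊆ S ∧ ∀ x ∈ W, G.neighbors x ⊆ S := by
  classical
  exact ⟨W ∪ W.biUnion G.neighbors, Finset.subset_union_left, fun x hx =>
    (Finset.subset_biUnion_of_mem _ hx).trans Finset.subset_union_right⟩

theorem sum_sum_swap (S : Finset V) (F : V → V → ℝ) :
    ∑ x ∈ S, ∑ y ∈ S, G.w x y * F x y = ∑ x ∈ S, ∑ y ∈ S, G.w x y * F y x := by
  rw [Finset.sum_comm]
  exact Finset.sum_congr rfl fun x _ => Finset.sum_congr rfl fun y _ => by rw [G.w_symm]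

/-- Green's formula for finitely supported `a`. -/
theorem green {W S : Finset V} (hWS : W ⊆ S) (hS : ∀ x ∈ W, G.neighbors x ⊆ S) {a : V → ℝ}
    (ha : ∀ x ∉ W, a x = 0) (h : V → ℝ) :
    ∑ x ∈ W, G.m x * (a x * G.laplacian h x) =
      -(1 / 2) * ∑ x ∈ S, ∑ y ∈ S, G.w x y * ((a y - a x) * (h y - h x)) := by
  have h1 : ∑ x ∈ W, G.m x * (a x * G.laplacian h x) =
      ∑ x ∈ S, ∑ y ∈ S, G.w x y * (a x * (h y - h x)) := by
    calc _ = ∑ x ∈ W, ∑ y ∈ S, G.w x y * (a x * (h y - h x)) := by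
          refine Finset.sum_congr rfl fun x hx => ?_
          rw [mul_left_comm, G.m_mul_laplacian h (hS x hx), Finset.mul_sum]
          exact Finset.sum_congr rfl fun y _ => by ring
      _ = _ := Finset.sum_subset hWS fun x _ hx => by simp [ha x hx]
  have h2 := G.sum_sum_swap S fun x y => a x * (h y - h x)
  have h3 : ∑ x ∈ S, ∑ y ∈ S, G.w x y * ((a y - a x) * (h y - h x)) =
      -(∑ x ∈ S, ∑ y ∈ S, G.w x y * (a x * (h y - h x)))
        - ∑ x ∈ S, ∑ y ∈ S, G.w x y * (a y * (h x - h y)) := by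
    simp only [← Finset.sum_neg_distrib, ← Finset.sum_sub_distrib]
    exact Finset.sum_congr rfl fun x _ => Finset.sum_congr rfl fun y _ => by ring
  rw [h1, h3]
  linarith

theorem sum_mul_laplacian_self_nonpos {W : Finset V} {h : V → ℝ} (hh : ∀ x ∉ W, h x = 0) :
    ∑ x ∈ W, G.m x * (h x * G.laplacian h x) ≤ 0 := by
  obtain ⟨S, hWS, hS⟩ := G.exists_hull W
  rw [G.green hWS hS hh]
  have : 0 ≤ ∑ x ∈ S, ∑ y ∈ S, G.w x y * ((h y - h x) * (h y - h x)) :=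
    Finset.sum_nonneg fun x _ => Finset.sum_nonneg fun y _ =>
      mul_nonneg (G.w_nonneg x y) (mul_self_nonneg _)
  linarith

/-- A Caccioppoli type inequality. -/
theorem caccioppoli {W S : Finset V} (hWS : W ⊆ S) (hS : ∀ x ∈ W, G.neighbors x ⊆ S)
    {η : V → ℝ} (hη : ∀ x ∉ W, η x = 0) {ε M : ℝ} (hε : ∀ x, G.gamma η x ≤ ε) (h : V → ℝ)
    (hM : ∑ x ∈ S, G.m x * h x ^ 2 ≤ M) (hε0 : 0 ≤ ε) :
    ∑ x ∈ W, G.m x * (η x ^ 2 * h x * G.laplacian h x)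
      + 1 / 2 * ∑ x ∈ S, ∑ y ∈ S, G.w x y * (η y * h y - η x * h x) ^ 2 ≤ ε * M := by
  classical
  have h1 := G.green hWS hS (a := fun x => η x ^ 2 * h x) (fun x hx => by simp [hη x hx]) h
  -- Completing the square isolates the energy of $\eta h$; the remainder involves only differences
  -- of $\eta$.
  have h2 : ∑ x ∈ S, ∑ y ∈ S, G.w x y * ((η y ^ 2 * h y - η x ^ 2 * h x) * (h y - h x)) =
      ∑ x ∈ S, ∑ y ∈ S, G.w x y * (η y * h y - η x * h x) ^ 2
        - ∑ x ∈ S, ∑ y ∈ S, G.w x y * (h x * h y * (η y - η x) ^ 2) := by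
    simp only [← Finset.sum_sub_distrib]
    exact Finset.sum_congr rfl fun x _ => Finset.sum_congr rfl fun y _ => by ring
  have h3 : ∑ x ∈ S, ∑ y ∈ S, G.w x y * (h x * h y * (η y - η x) ^ 2) ≤
      ∑ x ∈ S, ∑ y ∈ S, G.w x y * (h x ^ 2 * (η y - η x) ^ 2) := by
    have h4 := G.sum_sum_swap S fun x y => h x ^ 2 * (η y - η x) ^ 2
    have h5 : ∑ x ∈ S, ∑ y ∈ S, G.w x y * (h x * h y * (η y - η x) ^ 2) ≤
        1 / 2 * (∑ x ∈ S, ∑ y ∈ S, G.w x y * (h x ^ 2 * (η y - η x) ^ 2)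
          + ∑ x ∈ S, ∑ y ∈ S, G.w x y * (h y ^ 2 * (η x - η y) ^ 2)) := by
      simp only [← Finset.sum_add_distrib, Finset.mul_sum]
      refine Finset.sum_le_sum fun x _ => Finset.sum_le_sum fun y _ => ?_
      have := mul_nonneg (G.w_nonneg x y) (sq_nonneg ((h x - h y) * (η y - η x)))
      linarith
    linarith
  have h6 : 1 / 2 * ∑ x ∈ S, ∑ y ∈ S, G.w x y * (h x ^ 2 * (η y - η x) ^ 2) ≤ ε * M := by
    calc _ = ∑ x ∈ S, h x ^ 2 * (1 / 2 * ∑ y ∈ S, G.w x y * (η y - η x) ^ 2) := by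
          simp only [Finset.mul_sum]
          exact Finset.sum_congr rfl fun x _ => Finset.sum_congr rfl fun y _ => by ring
      _ ≤ ∑ x ∈ S, h x ^ 2 * (G.m x * ε) := by
          refine Finset.sum_le_sum fun x _ => mul_le_mul_of_nonneg_left ?_ (sq_nonneg _)
          calc _ ≤ 1 / 2 * ∑ y ∈ S ∪ G.neighbors x, G.w x y * (η y - η x) ^ 2 := by
                gcongr
                · exact fun _ _ _ => mul_nonneg (G.w_nonneg _ _) (sq_nonneg _)
                · exact Finset.subset_union_left
            _ = G.m x * G.gamma η x := (G.m_mul_gamma η Finset.subset_union_right).symm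
            _ ≤ _ := mul_le_mul_of_nonneg_left (hε x) (G.m_pos x).le
      _ = ε * ∑ x ∈ S, G.m x * h x ^ 2 := by
          rw [Finset.mul_sum]
          exact Finset.sum_congr rfl fun x _ => by ring
      _ ≤ _ := mul_le_mul_of_nonneg_left hM hε0
  rw [h1, h2]
  linarith

/-! ### Positive parts and the parabolic maximum principle -/

/-- Squaring removes the kink at $0$, so the $\ell^2$ norm of a positive part can be differentiated
in time. -/
theorem hasDerivAt_max_zero_sq (r : ℝ) :
    HasDerivAt (fun s : ℝ => max s 0 ^ 2) (2 * max r 0) r := by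
  rcases lt_trichotomy r 0 with hr | rfl | hr
  · rw [max_eq_right hr.le, mul_zero]
    refine (hasDerivAt_const r (0 : ℝ)).congr_of_eventuallyEq ?_
    filter_upwards [Iio_mem_nhds hr] with s hs
    simp [max_eq_right (mem_Iio.1 hs).le]
  · rw [hasDerivAt_iff_isLittleO]
    simp only [max_self, sub_zero, mul_zero, smul_zero]
    have h1 : (fun s : ℝ => max s 0 ^ 2 - 0 ^ 2) =O[𝓝 0] fun s : ℝ => s ^ 2 := by
      refine Asymptotics.IsBigO.of_bound 1 (Eventually.of_forall fun s => ?_)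
      simp only [Real.norm_eq_abs, one_mul]
      rcases le_total s 0 with h | h
      · simp [max_eq_right h, sq_nonneg]
      · simp [max_eq_left h]
    exact h1.trans_isLittleO (Asymptotics.isLittleO_pow_id one_lt_two)
  · rw [max_eq_left hr.le]
    refine ((hasDerivAt_pow 2 r).congr_deriv (by simp)).congr_of_eventuallyEq ?_
    filter_upwards [Ioi_mem_nhds hr] with s hs
    simp [max_eq_left (mem_Ioi.1 hs).le]

/-- The weighted `ℓ²` norm of the positive part of a subsolution of the heat equation. -/
theorem sum_max_sq_le {W : Finset V} (η : V → ℝ) {T C : ℝ} (hT : 0 ≤ T) {g g' : ℝ → V → ℝ}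
    (hc : ∀ x ∈ W, ContinuousOn (fun t => g t x) (Icc 0 T))
    (hd : ∀ x ∈ W, ∀ t ∈ Ioo 0 T, HasDerivAt (fun s => g s x) (g' t x) t)
    (hg : ∀ x ∈ W, ∀ t ∈ Ioo 0 T, 0 < g t x → g' t x ≤ G.laplacian (g t) x)
    (hC : ∀ t ∈ Ioo 0 T, ∑ x ∈ W, G.m x *
      (η x ^ 2 * max (g t x) 0 * G.laplacian (fun y => max (g t y) 0) x) ≤ C) :
    ∑ x ∈ W, G.m x * (η x ^ 2 * max (g T x) 0 ^ 2) ≤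
      ∑ x ∈ W, G.m x * (η x ^ 2 * max (g 0 x) 0 ^ 2) + 2 * C * T := by
  have hder : ∀ t ∈ Ioo 0 T,
      HasDerivAt (fun s => ∑ x ∈ W, G.m x * (η x ^ 2 * max (g s x) 0 ^ 2) - 2 * C * s)
        (∑ x ∈ W, G.m x * (η x ^ 2 * (2 * max (g t x) 0 * g' t x)) - 2 * C * 1) t := by
    intro t ht
    refine (HasDerivAt.fun_sum fun x hx => ?_).sub ((hasDerivAt_id t).const_mul _)
    have := (hasDerivAt_max_zero_sq (g t x)).comp t (hd x hx t ht)
    exact (this.const_mul _).const_mul _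
  have hanti : AntitoneOn
      (fun s => ∑ x ∈ W, G.m x * (η x ^ 2 * max (g s x) 0 ^ 2) - 2 * C * s) (Icc 0 T) := by
    refine antitoneOn_of_deriv_nonpos (convex_Icc 0 T) ?_ ?_ ?_
    · refine ContinuousOn.sub (continuousOn_finsetSum _ fun x hx => ?_) (by fun_prop)
      exact continuousOn_const.mul (continuousOn_const.mul
        (((hc x hx).sup continuousOn_const).pow 2))
    · rw [interior_Icc]
      exact fun t ht => (hder t ht).differentiableAt.differentiableWithinAt
    · rw [interior_Icc]
      intro t ht
      rw [(hder t ht).deriv]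
      have : ∑ x ∈ W, G.m x * (η x ^ 2 * (2 * max (g t x) 0 * g' t x)) ≤
          2 * ∑ x ∈ W, G.m x *
            (η x ^ 2 * max (g t x) 0 * G.laplacian (fun y => max (g t y) 0) x) := by
        rw [Finset.mul_sum]
        refine Finset.sum_le_sum fun x hx => ?_
        rcases le_or_gt (g t x) 0 with h0 | h0
        · simp [max_eq_right h0]
        -- Where $g>0$, passing to $g^+$ keeps the value at $x$ and can only raise the neighbours,
        -- so the Laplacian grows.
        · have h1 : g' t x ≤ G.laplacian (fun y => max (g t y) 0) x := by
            refine (hg x hx t ht h0).trans ?_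
            unfold laplacian
            have := G.m_pos x
            refine mul_le_mul_of_nonneg_left (Finset.sum_le_sum fun y _ =>
              mul_le_mul_of_nonneg_left ?_ (G.w_nonneg x y)) (by positivity)
            simp only [max_eq_left h0.le]
            linarith [le_max_left (g t y) 0]
          have h2 : 0 ≤ G.m x * (η x ^ 2 * (2 * max (g t x) 0)) := by
            have := G.m_pos x
            positivity
          nlinarith [mul_le_mul_of_nonneg_left h1 h2]
      linarith [hC t ht]
  have := hanti (left_mem_Icc.2 hT) (right_mem_Icc.2 hT) hT
  simp only at this
  linarith

/-- The Dirichlet `ℓ²` contraction for positive parts. -/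
theorem sum_max_sq_le_of_dirichlet {W : Finset V} {T : ℝ} (hT : 0 ≤ T) {g g' : ℝ → V → ℝ}
    (hc : ∀ x ∈ W, ContinuousOn (fun t => g t x) (Icc 0 T))
    (hd : ∀ x ∈ W, ∀ t ∈ Ioo 0 T, HasDerivAt (fun s => g s x) (g' t x) t)
    (hg : ∀ x ∈ W, ∀ t ∈ Ioo 0 T, 0 < g t x → g' t x ≤ G.laplacian (g t) x)
    (hW : ∀ x ∉ W, ∀ t ∈ Ioo 0 T, g t x ≤ 0) :
    ∑ x ∈ W, G.m x * max (g T x) 0 ^ 2 ≤ ∑ x ∈ W, G.m x * max (g 0 x) 0 ^ 2 := by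
  have := G.sum_max_sq_le (C := 0) (fun _ => 1) hT hc hd hg fun t ht => by
    simpa using G.sum_mul_laplacian_self_nonpos (h := fun x => max (g t x) 0)
      fun x hx => max_eq_right (hW x hx t ht)
  simpa using this

/-- The parabolic maximum principle on a finite set. -/
theorem nonpos_of_dirichlet {W : Finset V} {T : ℝ} (hT : 0 ≤ T) {g g' : ℝ → V → ℝ}
    (hc : ∀ x ∈ W, ContinuousOn (fun t => g t x) (Icc 0 T))
    (hd : ∀ x ∈ W, ∀ t ∈ Ioo 0 T, HasDerivAt (fun s => g s x) (g' t x) t)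
    (hg : ∀ x ∈ W, ∀ t ∈ Ioo 0 T, 0 < g t x → g' t x ≤ G.laplacian (g t) x)
    (hW : ∀ x ∉ W, ∀ t ∈ Ioo 0 T, g t x ≤ 0) (h0 : ∀ x ∈ W, g 0 x ≤ 0) {x : V} (hx : x ∈ W) :
    g T x ≤ 0 := by
  have h1 := G.sum_max_sq_le_of_dirichlet hT hc hd hg hW
  rw [Finset.sum_eq_zero (f := fun x => G.m x * max (g 0 x) 0 ^ 2) fun y hy => by
    simp [max_eq_right (h0 y hy)]] at h1
  have h2 := (Finset.single_le_sum (f := fun x => G.m x * max (g T x) 0 ^ 2)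
    (fun y _ => mul_nonneg (G.m_pos y).le (sq_nonneg _)) hx).trans h1
  by_contra h3
  push Not at h3
  simp only [max_eq_left h3.le] at h2
  have := mul_pos (G.m_pos x) (pow_pos h3 2)
  linarith

/-! ### Comparison and energy estimates on complete graphs -/

/-- Cutoff functions with values in `[0, 1]`. -/
structure IsCutoff (η : ℕ → V → ℝ) : Prop where
  nonneg : ∀ k x, 0 ≤ η k x
  le_one : ∀ k x, η k x ≤ 1
  finite_support : ∀ k, (Function.support (η k)).Finite
  tendsto : ∀ x, Tendsto (fun k => η k x) atTop (𝓝 1)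
  gamma_le : ∀ k x, G.gamma (η k) x ≤ 1 / ((k : ℝ) + 1)

variable {G}

/-- Taking positive parts contracts differences, so $\Gamma$ does not grow. The bound by $1$ comes
from monotone convergence to $1$. -/
theorem IsComplete.exists_isCutoff (h : G.IsComplete) : ∃ η, G.IsCutoff η := by
  obtain ⟨η, hmono, hfin, hlim, hΓ⟩ := h
  refine ⟨fun k x => max (η k x) 0, fun k x => le_max_right _ _, fun k x => ?_, fun k => ?_,
    fun x => ?_, fun k x => ?_⟩
  · exact max_le (Monotone.ge_of_tendsto (fun i j hij => hmono hij x) (hlim x) k) zero_le_one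
  · refine (hfin k).subset fun x hx => ?_
    rw [Function.mem_support] at hx ⊢
    rintro h0
    simp [h0] at hx
  · simpa using (hlim x).max (tendsto_const_nhds (x := (0 : ℝ)))
  · refine (G.gamma_le_gamma fun y => ?_).trans (hΓ k x)
    exact sq_le_sq.2 (abs_max_sub_max_le_abs _ _ _)

namespace IsCutoff

variable {η : ℕ → V → ℝ} (hη : G.IsCutoff η)
include hη

/-- Makes the directed set of finite $W\subset V$ countably generated, as dominated convergence of
time integrals along it requires. -/
theorem countable : Countable V := by
  have : (⋃ k, Function.support (η k)) = univ := by
    refine eq_univ_of_forall fun x => ?_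
    obtain ⟨k, hk⟩ := ((hη.tendsto x).eventually_ne one_ne_zero).exists
    exact mem_iUnion.2 ⟨k, hk⟩
  rw [← Set.countable_univ_iff, ← this]
  exact countable_iUnion fun k => (hη.finite_support k).countable

/-- The parabolic comparison principle in `ℓ²` on a complete graph. -/
theorem nonpos_of_subsolution {T M : ℝ} (hT : 0 ≤ T) {g g' : ℝ → V → ℝ}
    (hc : ∀ x, ContinuousOn (fun t => g t x) (Icc 0 T))
    (hd : ∀ x, ∀ t ∈ Ioo 0 T, HasDerivAt (fun s => g s x) (g' t x) t)
    (hg : ∀ x, ∀ t ∈ Ioo 0 T, 0 < g t x → g' t x ≤ G.laplacian (g t) x)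
    (h0 : ∀ x, g 0 x ≤ 0)
    (hM : ∀ t ∈ Ioo 0 T, ∀ S : Finset V, ∑ x ∈ S, G.m x * max (g t x) 0 ^ 2 ≤ M) (x : V) :
    g T x ≤ 0 := by
  -- The Caccioppoli inequality costs $M/(k+1)$ per unit of time, which vanishes as $k\to\infty$.
  have key : ∀ k, G.m x * (η k x ^ 2 * max (g T x) 0 ^ 2) ≤ 2 * (1 / ((k : ℝ) + 1) * M) * T := by
    intro k
    set W := (hη.finite_support k).toFinset
    have hW : ∀ y ∉ W, η k y = 0 := fun y hy => by simpa [W] using hy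
    obtain ⟨S, hWS, hS⟩ := G.exists_hull W
    have h1 := G.sum_max_sq_le (W := W) (η k) hT (fun x _ => hc x) (fun x _ => hd x)
      (fun x _ => hg x) (C := 1 / ((k : ℝ) + 1) * M) fun t ht => by
        have := G.caccioppoli hWS hS hW (hη.gamma_le k) (fun x => max (g t x) 0) (hM t ht S)
          (by positivity)
        have h2 : 0 ≤ ∑ x ∈ S, ∑ y ∈ S,
            G.w x y * (η k y * max (g t y) 0 - η k x * max (g t x) 0) ^ 2 :=
          Finset.sum_nonneg fun x _ => Finset.sum_nonneg fun y _ =>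
            mul_nonneg (G.w_nonneg x y) (sq_nonneg _)
        linarith
    rw [Finset.sum_eq_zero (f := fun x => G.m x * (η k x ^ 2 * max (g 0 x) 0 ^ 2)) fun y hy => by
      simp [max_eq_right (h0 y)], zero_add] at h1
    by_cases hx : x ∈ W
    · exact (Finset.single_le_sum (f := fun x => G.m x * (η k x ^ 2 * max (g T x) 0 ^ 2))
        (fun y _ => mul_nonneg (G.m_pos y).le (by positivity)) hx).trans h1
    · refine le_trans ?_ h1
      rw [hW x hx]
      simpa using Finset.sum_nonneg (s := W) (f := fun x => G.m x * (η k x ^ 2 * max (g T x) 0 ^ 2))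
        fun y _ => mul_nonneg (G.m_pos y).le (by positivity)
  have hl : Tendsto (fun k => G.m x * (η k x ^ 2 * max (g T x) 0 ^ 2)) atTop
      (𝓝 (G.m x * (1 ^ 2 * max (g T x) 0 ^ 2))) :=
    (((hη.tendsto x).pow 2).mul_const _).const_mul _
  have hr : Tendsto (fun k : ℕ => 2 * (1 / ((k : ℝ) + 1) * M) * T) atTop
      (𝓝 (2 * (0 * M) * T)) :=
    ((tendsto_one_div_add_atTop_nhds_zero_nat.mul_const M).const_mul 2).mul_const T
  have h2 := le_of_tendsto_of_tendsto' hl hr key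
  by_contra h3
  push Not at h3
  simp only [max_eq_left h3.le] at h2
  have := mul_pos (G.m_pos x) (pow_pos h3 2)
  linarith

/-- The energy bound `‖∇u‖² ≤ ‖u‖ ‖Δu‖`, in a weak form. -/
theorem sum_gamma_le {u : V → ℝ} {M M' : ℝ} (hM : ∀ S : Finset V, ∑ x ∈ S, G.m x * u x ^ 2 ≤ M)
    (hM' : ∀ S : Finset V, ∑ x ∈ S, G.m x * G.laplacian u x ^ 2 ≤ M') (S₀ : Finset V) :
    ∑ x ∈ S₀, G.m x * G.gamma u x ≤ 2 * M + M' := by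
  classical
  have hM0 : 0 ≤ M := by simpa using hM ∅
  have key : ∀ k, ∑ x ∈ S₀, G.m x * G.gamma (fun y => η k y * u y) x ≤ 2 * M + M' := by
    intro k
    set W := (hη.finite_support k).toFinset
    have hW : ∀ y ∉ W, η k y = 0 := fun y hy => by simpa [W] using hy
    obtain ⟨S, hWS, hS⟩ := G.exists_hull (W ∪ S₀)
    have h1 := G.caccioppoli (Finset.subset_union_left.trans hWS)
      (fun x hx => hS x (Finset.mem_union_left _ hx)) hW (hη.gamma_le k) u (hM S) (by positivity)
    have h2 : ∑ x ∈ S₀, G.m x * G.gamma (fun y => η k y * u y) x ≤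
        1 / 2 * ∑ x ∈ S, ∑ y ∈ S, G.w x y * (η k y * u y - η k x * u x) ^ 2 := by
      rw [Finset.mul_sum]
      calc _ = ∑ x ∈ S₀, 1 / 2 * ∑ y ∈ S, G.w x y * (η k y * u y - η k x * u x) ^ 2 :=
            Finset.sum_congr rfl fun x hx =>
              G.m_mul_gamma _ (hS x (Finset.mem_union_right _ hx))
        _ ≤ _ := Finset.sum_le_sum_of_subset_of_nonneg (Finset.subset_union_right.trans hWS)
            fun x _ _ => mul_nonneg (by norm_num) (Finset.sum_nonneg fun y _ =>
              mul_nonneg (G.w_nonneg x y) (sq_nonneg _))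
    have h3 : -∑ x ∈ W, G.m x * (η k x ^ 2 * u x * G.laplacian u x) ≤ M + M' := by
      refine le_trans ?_ (add_le_add (hM W) (hM' W))
      rw [← Finset.sum_add_distrib, ← Finset.sum_neg_distrib]
      refine Finset.sum_le_sum fun x _ => ?_
      rw [← mul_add, ← mul_neg]
      refine mul_le_mul_of_nonneg_left ?_ (G.m_pos x).le
      have h4 : |η k x ^ 2 * (u x * G.laplacian u x)| ≤ |u x * G.laplacian u x| := by
        rw [abs_mul, abs_of_nonneg (sq_nonneg _)]
        exact mul_le_of_le_one_left (abs_nonneg _) (pow_le_one₀ (hη.nonneg k x) (hη.le_one k x))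
      have h5 : |u x * G.laplacian u x| ≤ u x ^ 2 + G.laplacian u x ^ 2 :=
        abs_le.2 ⟨by nlinarith [sq_nonneg (u x + G.laplacian u x)],
          by nlinarith [sq_nonneg (u x - G.laplacian u x)]⟩
      have h6 := neg_abs_le (η k x ^ 2 * (u x * G.laplacian u x))
      linarith
    -- The cutoff error accounts for the second $M$ in the bound.
    have h7 : 1 / ((k : ℝ) + 1) * M ≤ M :=
      mul_le_of_le_one_left hM0 (by rw [div_le_one (by positivity)]; linarith [k.cast_nonneg (α := ℝ)])
    linarith
  refine le_of_tendsto' (x := atTop) (tendsto_finsetSum S₀ fun x _ =>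
    (G.gamma_tendsto (fun y => ?_) x).const_mul (G.m x)) key
  simpa using (hη.tendsto y).mul_const (u y)

end IsCutoff

variable (G)

/-! ### The Dirichlet semigroup on a finite set -/

theorem laplacian_sum_mul {ι : Type*} (s : Finset ι) (c : ι → ℝ) (F : ι → V → ℝ) (x : V) :
    G.laplacian (fun z => ∑ i ∈ s, c i * F i z) x = ∑ i ∈ s, c i * G.laplacian (F i) x := by
  simp only [laplacian, ← Finset.sum_sub_distrib, Finset.mul_sum]
  rw [Finset.sum_comm]
  exact Finset.sum_congr rfl fun i _ => Finset.sum_congr rfl fun y _ => by ring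

theorem abs_laplacian_le {f : V → ℝ} {C : ℝ} (hf : ∀ x, |f x| ≤ C) (x : V) :
    |G.laplacian f x| ≤ 1 / G.m x * ∑ y ∈ G.neighbors x, G.w x y * (2 * C) := by
  have := G.m_pos x
  rw [laplacian, abs_mul, abs_of_nonneg (by positivity : 0 ≤ 1 / G.m x)]
  refine mul_le_mul_of_nonneg_left ((Finset.abs_sum_le_sum_abs _ _).trans
    (Finset.sum_le_sum fun y _ => ?_)) (by positivity)
  rw [abs_mul, abs_of_nonneg (G.w_nonneg x y)]
  refine mul_le_mul_of_nonneg_left ?_ (G.w_nonneg x y)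
  linarith [abs_sub (f y) (f x), hf x, hf y]

/-- The Dirichlet heat semigroup on a finite vertex set. -/
noncomputable def dirichletSemigroup (W : Finset V) (t : ℝ) (f : V → ℝ) (x : V) : ℝ :=
  ∑ y ∈ W, G.dirichletHeatKernel W t x y * f y

variable {W : Finset V}

theorem dirichletHeatKernel_eq_zero {x y : V} (t : ℝ) (h : ¬(x ∈ W ∧ y ∈ W)) :
    G.dirichletHeatKernel W t x y = 0 := by
  rw [dirichletHeatKernel, dif_neg h]

theorem dirichletSemigroup_eq_zero {x : V} (hx : x ∉ W) (t : ℝ) (f : V → ℝ) :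
    G.dirichletSemigroup W t f x = 0 :=
  Finset.sum_eq_zero fun y _ => by
    rw [G.dirichletHeatKernel_eq_zero t fun h => hx h.1, zero_mul]

open Classical in
theorem dirichletSemigroup_eq_mulVec (t : ℝ) (f : V → ℝ) (x : W) :
    G.dirichletSemigroup W t f x =
      (NormedSpace.exp (t • G.dirichletMatrix W)).mulVec (fun y => f y) x := by
  rw [dirichletSemigroup, Matrix.mulVec, dotProduct, ← Finset.sum_coe_sort]
  exact Finset.sum_congr rfl fun y _ => by
    rw [dirichletHeatKernel, dif_pos ⟨x.2, y.2⟩]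

theorem dirichletMatrix_mulVec {f : V → ℝ} (hf : ∀ x ∉ W, f x = 0) (x : W) :
    (G.dirichletMatrix W).mulVec (fun y => f y) x = G.laplacian f x := by
  classical
  have h : f = fun z => ∑ y ∈ W, f y * (Pi.single y (1 : ℝ) : V → ℝ) z := by
    funext z
    by_cases hz : z ∈ W
    · rw [Finset.sum_eq_single_of_mem z hz fun y _ hy => by
        rw [Pi.single_eq_of_ne hy.symm, mul_zero]]
      simp
    · rw [hf z hz, Finset.sum_eq_zero fun y hy => ?_]
      rw [Pi.single_eq_of_ne (fun h : z = y => hz (h ▸ hy)), mul_zero]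
  conv_rhs => rw [h, laplacian_sum_mul]
  rw [← Finset.sum_coe_sort W fun y => f y * G.laplacian (Pi.single y 1) x]
  refine Finset.sum_congr rfl fun y _ => ?_
  change G.laplacian (Pi.single (y : V) 1) x * f y = _
  rw [mul_comm]

theorem dirichletSemigroup_zero {x : V} (hx : x ∈ W) (f : V → ℝ) :
    G.dirichletSemigroup W 0 f x = f x := by
  classical
  rw [G.dirichletSemigroup_eq_mulVec 0 f ⟨x, hx⟩, zero_smul, NormedSpace.exp_zero,
    Matrix.one_mulVec]

section MatrixNorm

attribute [local instance] Matrix.linftyOpNormedAddCommGroup Matrix.linftyOpNormedRing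
  Matrix.linftyOpNormedAlgebra

/-- Differentiating the exponential needs some Banach algebra norm on matrices; the local choice
does not affect the result. -/
theorem exp_smul_mulVec_hasDerivAt {n : Type*} [Fintype n] [DecidableEq n] (A : Matrix n n ℝ)
    (v : n → ℝ) (i : n) (t : ℝ) :
    HasDerivAt (fun s : ℝ => (NormedSpace.exp (s • A)).mulVec v i)
      (A.mulVec ((NormedSpace.exp (t • A)).mulVec v) i) t := by
  have h := hasDerivAt_exp_smul_const' A t
  let L : Matrix n n ℝ →ₗ[ℝ] ℝ :=
    { toFun := fun B => B.mulVec v i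
      map_add' := fun B B' => by simp [Matrix.add_mulVec]
      map_smul' := fun c B => by simp [Matrix.smul_mulVec] }
  have h2 := (LinearMap.toContinuousLinearMap L).hasFDerivAt.comp_hasDerivAt t h
  rw [Matrix.mulVec_mulVec]
  exact h2

/-- $A e^{tA}$ and $e^{tA}A$ are both the derivative of $e^{tA}$. -/
theorem exp_smul_mulVec_comm {n : Type*} [Fintype n] [DecidableEq n] (A : Matrix n n ℝ)
    (v : n → ℝ) (t : ℝ) :
    A.mulVec ((NormedSpace.exp (t • A)).mulVec v) =
      (NormedSpace.exp (t • A)).mulVec (A.mulVec v) := by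
  rw [Matrix.mulVec_mulVec, Matrix.mulVec_mulVec]
  exact congrArg (fun B : Matrix n n ℝ => B.mulVec v)
    ((hasDerivAt_exp_smul_const' A t).unique (hasDerivAt_exp_smul_const A t))

end MatrixNorm

theorem laplacian_dirichletSemigroup_eq_mulVec [DecidableEq W] (t : ℝ) (f : V → ℝ) (x : W) :
    G.laplacian (G.dirichletSemigroup W t f) x = (G.dirichletMatrix W).mulVec
      ((NormedSpace.exp (t • G.dirichletMatrix W)).mulVec fun y => f y) x := by
  rw [← G.dirichletMatrix_mulVec fun y hy => G.dirichletSemigroup_eq_zero hy t f]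
  congr 1
  funext y
  rw [G.dirichletSemigroup_eq_mulVec t f y]
  congr!

theorem dirichletSemigroup_hasDerivAt {x : V} (hx : x ∈ W) (f : V → ℝ) (t : ℝ) :
    HasDerivAt (fun s => G.dirichletSemigroup W s f x)
      (G.laplacian (G.dirichletSemigroup W t f) x) t := by
  classical
  rw [G.laplacian_dirichletSemigroup_eq_mulVec t f ⟨x, hx⟩]
  have := exp_smul_mulVec_hasDerivAt (G.dirichletMatrix W) (fun y => f y) ⟨x, hx⟩ t
  convert this using 2 with s
  rw [G.dirichletSemigroup_eq_mulVec s f ⟨x, hx⟩]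

/-- Since $f$ vanishes off $W$, the Dirichlet matrix acts on it as $\Delta$, and the matrix commutes
with its exponential. -/
theorem laplacian_dirichletSemigroup {f : V → ℝ} (hf : ∀ x ∉ W, f x = 0) {x : V} (hx : x ∈ W)
    (t : ℝ) : G.laplacian (G.dirichletSemigroup W t f) x =
      G.dirichletSemigroup W t (G.laplacian f) x := by
  classical
  rw [G.laplacian_dirichletSemigroup_eq_mulVec t f ⟨x, hx⟩, exp_smul_mulVec_comm,
    G.dirichletSemigroup_eq_mulVec t _ ⟨x, hx⟩]
  have : (G.dirichletMatrix W).mulVec (fun y => f y) = fun y : W => G.laplacian f y :=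
    funext fun y => G.dirichletMatrix_mulVec hf y
  rw [this]

theorem dirichletSemigroup_continuous (f : V → ℝ) (x : V) :
    Continuous fun s => G.dirichletSemigroup W s f x := by
  by_cases hx : x ∈ W
  · exact continuous_iff_continuousAt.2 fun t =>
      (G.dirichletSemigroup_hasDerivAt hx f t).continuousAt
  · simp only [G.dirichletSemigroup_eq_zero hx]
    exact continuous_const

theorem dirichletSemigroup_nonneg {f : V → ℝ} (hf : ∀ x, 0 ≤ f x) {t : ℝ} (ht : 0 ≤ t) (x : V) :
    0 ≤ G.dirichletSemigroup W t f x := by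
  by_cases hx : x ∈ W
  · have := G.nonpos_of_dirichlet (W := W) ht
      (g := fun s y => -1 * G.dirichletSemigroup W s f y)
      (g' := fun s y => -1 * G.laplacian (G.dirichletSemigroup W s f) y)
      (fun y _ => (continuous_const.mul (G.dirichletSemigroup_continuous f y)).continuousOn)
      (fun y hy s _ => (G.dirichletSemigroup_hasDerivAt hy f s).const_mul _)
      (fun y _ s _ _ => (G.laplacian_const_mul _ _ _).ge)
      (fun y hy s _ => by simp [G.dirichletSemigroup_eq_zero hy])
      (fun y hy => by simpa [G.dirichletSemigroup_zero hy] using hf y) hx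
    linarith
  · exact (G.dirichletSemigroup_eq_zero hx t f).ge

/-- The difference of the two solutions solves the heat equation in $W$, starts at $0$, and is
$\le0$ off $W$ because the larger solution is nonnegative. -/
theorem dirichletSemigroup_mono {W' : Finset V} (hW : W ⊆ W') {f : V → ℝ} (hf : ∀ x, 0 ≤ f x)
    {t : ℝ} (ht : 0 ≤ t) (x : V) :
    G.dirichletSemigroup W t f x ≤ G.dirichletSemigroup W' t f x := by
  by_cases hx : x ∈ W
  · have := G.nonpos_of_dirichlet (W := W) ht
      (g := fun s y => G.dirichletSemigroup W s f y + -1 * G.dirichletSemigroup W' s f y)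
      (g' := fun s y => G.laplacian (G.dirichletSemigroup W s f) y
        + -1 * G.laplacian (G.dirichletSemigroup W' s f) y)
      (fun y _ => ((G.dirichletSemigroup_continuous f y).add
        (continuous_const.mul (G.dirichletSemigroup_continuous f y))).continuousOn)
      (fun y hy s _ => (G.dirichletSemigroup_hasDerivAt hy f s).add
        ((G.dirichletSemigroup_hasDerivAt (hW hy) f s).const_mul _))
      (fun y _ s _ _ => by rw [laplacian_add, laplacian_const_mul])
      (fun y hy s hs => by
        have := G.dirichletSemigroup_nonneg (W := W') hf hs.1.le y
        simp only [G.dirichletSemigroup_eq_zero hy]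
        linarith)
      (fun y hy => by
        simp [G.dirichletSemigroup_zero hy, G.dirichletSemigroup_zero (hW hy)]) hx
    linarith
  · rw [G.dirichletSemigroup_eq_zero hx t f]
    exact G.dirichletSemigroup_nonneg hf ht x

theorem dirichletSemigroup_le {C : ℝ} (hC : 0 ≤ C) {f : V → ℝ} (hf : ∀ x, f x ≤ C)
    {t : ℝ} (ht : 0 ≤ t) (x : V) : G.dirichletSemigroup W t f x ≤ C := by
  by_cases hx : x ∈ W
  · have := G.nonpos_of_dirichlet (W := W) ht
      (g := fun s y => G.dirichletSemigroup W s f y - C)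
      (g' := fun s y => G.laplacian (G.dirichletSemigroup W s f) y)
      (fun y _ => ((G.dirichletSemigroup_continuous f y).sub continuous_const).continuousOn)
      (fun y hy s _ => (G.dirichletSemigroup_hasDerivAt hy f s).sub_const _)
      (fun y _ s _ _ => (G.laplacian_sub_const _ _ _).ge)
      (fun y hy s _ => by simpa [G.dirichletSemigroup_eq_zero hy] using hC)
      (fun y hy => by simpa [G.dirichletSemigroup_zero hy] using hf y) hx
    linarith
  · rwa [G.dirichletSemigroup_eq_zero hx t f]

theorem dirichletSemigroup_neg (t : ℝ) (f : V → ℝ) (x : V) :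
    G.dirichletSemigroup W t (fun y => -f y) x = -G.dirichletSemigroup W t f x := by
  simp [dirichletSemigroup]

theorem abs_dirichletSemigroup_le {C : ℝ} {f : V → ℝ} (hf : ∀ x, |f x| ≤ C)
    {t : ℝ} (ht : 0 ≤ t) (x : V) : |G.dirichletSemigroup W t f x| ≤ C := by
  have hC : 0 ≤ C := (abs_nonneg _).trans (hf x)
  rw [abs_le']
  refine ⟨G.dirichletSemigroup_le hC (fun y => (abs_le'.1 (hf y)).1) ht x, ?_⟩
  rw [← dirichletSemigroup_neg]
  exact G.dirichletSemigroup_le hC (fun y => (abs_le'.1 (hf y)).2) ht x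

/-- Apply the contraction of positive parts to $f$ and $-f$ and add. -/
theorem sum_dirichletSemigroup_sq_le {f : V → ℝ} {t : ℝ} (ht : 0 ≤ t) :
    ∑ x ∈ W, G.m x * G.dirichletSemigroup W t f x ^ 2 ≤ ∑ x ∈ W, G.m x * f x ^ 2 := by
  have pos : ∀ h : V → ℝ, ∑ x ∈ W, G.m x * max (G.dirichletSemigroup W t h x) 0 ^ 2 ≤
      ∑ x ∈ W, G.m x * max (h x) 0 ^ 2 := by
    intro h
    refine (G.sum_max_sq_le_of_dirichlet (W := W) ht (g := fun s y => G.dirichletSemigroup W s h y)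
      (fun y _ => (G.dirichletSemigroup_continuous h y).continuousOn)
      (fun y hy s _ => G.dirichletSemigroup_hasDerivAt hy h s)
      (fun y _ s _ _ => le_rfl)
      (fun y hy s _ => (G.dirichletSemigroup_eq_zero hy s h).le)).trans_eq ?_
    exact Finset.sum_congr rfl fun x hx => by rw [G.dirichletSemigroup_zero hx]
  have split : ∀ h : V → ℝ, ∑ x ∈ W, G.m x * h x ^ 2 =
      ∑ x ∈ W, G.m x * max (h x) 0 ^ 2 + ∑ x ∈ W, G.m x * max (-h x) 0 ^ 2 := by
    intro h
    rw [← Finset.sum_add_distrib]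
    refine Finset.sum_congr rfl fun x _ => ?_
    rcases le_total (h x) 0 with h0 | h0
    · rw [max_eq_right h0, max_eq_left (neg_nonneg.2 h0)]
      ring
    · rw [max_eq_left h0, max_eq_right (neg_nonpos.2 h0)]
      ring
  have h1 := pos f
  have h2 := pos fun y => -f y
  simp only [dirichletSemigroup_neg] at h2
  rw [split f, split (G.dirichletSemigroup W t f)]
  linarith

theorem dirichletHeatKernel_eq_dirichletSemigroup [DecidableEq V] (t : ℝ) (x y : V) :
    G.dirichletHeatKernel W t x y = G.dirichletSemigroup W t (Pi.single y 1) x := by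
  by_cases hy : y ∈ W
  · rw [dirichletSemigroup, Finset.sum_eq_single_of_mem y hy fun z _ hz => by
      rw [Pi.single_eq_of_ne hz, mul_zero]]
    simp
  · rw [G.dirichletHeatKernel_eq_zero t fun h => hy h.2, dirichletSemigroup,
      Finset.sum_eq_zero fun z hz => ?_]
    rw [Pi.single_eq_of_ne (fun h : z = y => hy (h ▸ hz)), mul_zero]

theorem single_one_nonneg [DecidableEq V] (y z : V) : 0 ≤ (Pi.single y (1 : ℝ) : V → ℝ) z := by
  rw [Pi.single_apply]
  split_ifs <;> norm_num

theorem dirichletHeatKernel_nonneg {t : ℝ} (ht : 0 ≤ t) (x y : V) :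
    0 ≤ G.dirichletHeatKernel W t x y := by
  classical
  rw [dirichletHeatKernel_eq_dirichletSemigroup]
  exact G.dirichletSemigroup_nonneg (single_one_nonneg y) ht x

theorem dirichletHeatKernel_mono {t : ℝ} (ht : 0 ≤ t) (x y : V) :
    Monotone fun W => G.dirichletHeatKernel W t x y := by
  classical
  intro W W' h
  simp only [dirichletHeatKernel_eq_dirichletSemigroup]
  exact G.dirichletSemigroup_mono h (single_one_nonneg y) ht x

theorem sum_dirichletHeatKernel_le_one {t : ℝ} (ht : 0 ≤ t) (x : V) (S : Finset V) :
    ∑ y ∈ S, G.dirichletHeatKernel W t x y ≤ 1 := by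
  classical
  calc _ = ∑ y ∈ S ∩ W, G.dirichletHeatKernel W t x y :=
        (Finset.sum_subset Finset.inter_subset_left fun y hy hy' =>
          G.dirichletHeatKernel_eq_zero t fun h =>
            hy' (Finset.mem_inter.2 ⟨hy, h.2⟩)).symm
    _ ≤ ∑ y ∈ W, G.dirichletHeatKernel W t x y :=
        Finset.sum_le_sum_of_subset_of_nonneg Finset.inter_subset_right fun y _ _ =>
          G.dirichletHeatKernel_nonneg ht x y
    _ = G.dirichletSemigroup W t (fun _ => 1) x := by simp [dirichletSemigroup]
    _ ≤ 1 := G.dirichletSemigroup_le zero_le_one (fun _ => le_rfl) ht x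

/-! ### The minimal heat semigroup by exhaustion -/

theorem heatKernel_tendsto {t : ℝ} (ht : 0 ≤ t) (x y : V) :
    Tendsto (fun W => G.dirichletHeatKernel W t x y) atTop (𝓝 (G.heatKernel t x y)) := by
  refine tendsto_atTop_ciSup (G.dirichletHeatKernel_mono ht x y) ⟨1, ?_⟩
  rintro _ ⟨W, rfl⟩
  simpa using G.sum_dirichletHeatKernel_le_one (W := W) ht x {y}

theorem dirichletHeatKernel_le {t : ℝ} (ht : 0 ≤ t) (x y : V) (W : Finset V) :
    G.dirichletHeatKernel W t x y ≤ G.heatKernel t x y :=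
  (G.dirichletHeatKernel_mono ht x y).ge_of_tendsto (G.heatKernel_tendsto ht x y) W

theorem heatKernel_nonneg {t : ℝ} (ht : 0 ≤ t) (x y : V) : 0 ≤ G.heatKernel t x y :=
  (G.dirichletHeatKernel_nonneg ht x y).trans (G.dirichletHeatKernel_le ht x y ∅)

theorem heatKernel_summable {t : ℝ} (ht : 0 ≤ t) (x : V) : Summable (G.heatKernel t x) :=
  summable_of_sum_le (G.heatKernel_nonneg ht x) fun S =>
    le_of_tendsto' (tendsto_finsetSum S fun y _ => G.heatKernel_tendsto ht x y) fun _ =>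
      G.sum_dirichletHeatKernel_le_one ht x S

theorem heatKernel_mul_summable {t : ℝ} (ht : 0 ≤ t) (x : V) {f : V → ℝ} {C : ℝ}
    (hf : ∀ x, |f x| ≤ C) : Summable fun y => G.heatKernel t x y * f y := by
  refine Summable.of_norm_bounded ((G.heatKernel_summable ht x).mul_right C) fun y => ?_
  rw [Real.norm_eq_abs, abs_mul, abs_of_nonneg (G.heatKernel_nonneg ht x y)]
  exact mul_le_mul_of_nonneg_left (hf y) (G.heatKernel_nonneg ht x y)

theorem heatSemigroup_tendsto {t : ℝ} (ht : 0 ≤ t) {f : V → ℝ} {C : ℝ} (hf : ∀ x, |f x| ≤ C)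
    (x : V) : Tendsto (fun W => G.dirichletSemigroup W t f x) atTop (𝓝 (G.heatSemigroup t f x)) := by
  have h : ∀ W, G.dirichletSemigroup W t f x = ∑' y, G.dirichletHeatKernel W t x y * f y :=
    fun W => (tsum_eq_sum fun y hy => by
      rw [G.dirichletHeatKernel_eq_zero t fun h => hy h.2, zero_mul]).symm
  simp only [h]
  refine tendsto_tsum_of_dominated_convergence ((G.heatKernel_summable ht x).mul_right C)
    (fun y => (G.heatKernel_tendsto ht x y).mul_const _) (Eventually.of_forall fun W y => ?_)
  rw [Real.norm_eq_abs, abs_mul, abs_of_nonneg (G.dirichletHeatKernel_nonneg ht x y)]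
  exact mul_le_mul (G.dirichletHeatKernel_le ht x y W) (hf y) (abs_nonneg _)
    (G.heatKernel_nonneg ht x y)

theorem heatSemigroup_tendsto_of_dominated {t : ℝ} (ht : 0 ≤ t) {f : ℕ → V → ℝ} {g : V → ℝ}
    {C : ℝ} (hf : ∀ k x, |f k x| ≤ C) (h : ∀ x, Tendsto (fun k => f k x) atTop (𝓝 (g x)))
    (x : V) : Tendsto (fun k => G.heatSemigroup t (f k) x) atTop (𝓝 (G.heatSemigroup t g x)) := by
  refine tendsto_tsum_of_dominated_convergence ((G.heatKernel_summable ht x).mul_right C)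
    (fun y => (h y).const_mul _) (Eventually.of_forall fun k y => ?_)
  rw [Real.norm_eq_abs, abs_mul, abs_of_nonneg (G.heatKernel_nonneg ht x y)]
  exact mul_le_mul_of_nonneg_left (hf k y) (G.heatKernel_nonneg ht x y)

theorem heatSemigroup_nonneg {t : ℝ} (ht : 0 ≤ t) {f : V → ℝ} (hf : ∀ x, 0 ≤ f x) (x : V) :
    0 ≤ G.heatSemigroup t f x :=
  tsum_nonneg fun y => mul_nonneg (G.heatKernel_nonneg ht x y) (hf y)

theorem heatSemigroup_zero {f : V → ℝ} {C : ℝ} (hf : ∀ x, |f x| ≤ C) (x : V) :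
    G.heatSemigroup 0 f x = f x := by
  refine tendsto_nhds_unique (G.heatSemigroup_tendsto le_rfl hf x) ?_
  refine tendsto_const_nhds.congr' ?_
  filter_upwards [eventually_ge_atTop {x}] with W hW
  exact (G.dirichletSemigroup_zero (Finset.singleton_subset_iff.1 hW) f).symm

theorem sum_heatSemigroup_sq_le {t : ℝ} (ht : 0 ≤ t) {f : V → ℝ} {C M : ℝ} (hf : ∀ x, |f x| ≤ C)
    (hM : ∀ S : Finset V, ∑ x ∈ S, G.m x * f x ^ 2 ≤ M) (S : Finset V) :
    ∑ x ∈ S, G.m x * G.heatSemigroup t f x ^ 2 ≤ M := by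
  refine le_of_tendsto (tendsto_finsetSum S fun x _ =>
    ((G.heatSemigroup_tendsto ht hf x).pow 2).const_mul (G.m x)) ?_
  filter_upwards [eventually_ge_atTop S] with W hW
  refine (Finset.sum_le_sum_of_subset_of_nonneg hW fun x _ _ =>
    mul_nonneg (G.m_pos x).le (sq_nonneg _)).trans ?_
  exact (G.sum_dirichletSemigroup_sq_le ht).trans (hM W)

/-- Commutation holds for every finite $W$ containing $x$ and the support of $f$, and passes to the
limit. -/
theorem laplacian_heatSemigroup {t : ℝ} (ht : 0 ≤ t) {f : V → ℝ} (hf : (Function.support f).Finite)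
    {C C' : ℝ} (hC : ∀ x, |f x| ≤ C) (hC' : ∀ x, |G.laplacian f x| ≤ C') (x : V) :
    G.laplacian (G.heatSemigroup t f) x = G.heatSemigroup t (G.laplacian f) x := by
  refine tendsto_nhds_unique (G.laplacian_tendsto (fun y => G.heatSemigroup_tendsto ht hC y) x) ?_
  refine (G.heatSemigroup_tendsto ht hC' x).congr' ?_
  classical
  filter_upwards [eventually_ge_atTop (insert x hf.toFinset)] with W hW
  refine (G.laplacian_dirichletSemigroup (fun y hy => ?_) (hW (Finset.mem_insert_self _ _)) t).symm
  by_contra h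
  exact hy (hW (Finset.mem_insert_of_mem (by simpa using h)))

/-! ### Time regularity and the heat equation -/

/-- At a fixed vertex, local finiteness bounds the time derivative of the Dirichlet solutions
independently of $W$. -/
theorem heatSemigroup_lipschitz {f : V → ℝ} {C : ℝ} (hf : ∀ x, |f x| ≤ C) (x : V) {s t : ℝ}
    (hs : 0 ≤ s) (ht : 0 ≤ t) : |G.heatSemigroup t f x - G.heatSemigroup s f x| ≤
      (1 / G.m x * ∑ y ∈ G.neighbors x, G.w x y * (2 * C)) * |t - s| := by
  refine le_of_tendsto ((G.heatSemigroup_tendsto ht hf x).sub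
    (G.heatSemigroup_tendsto hs hf x)).abs ?_
  filter_upwards [eventually_ge_atTop {x}] with W hW
  exact (convex_Ici (0 : ℝ)).norm_image_sub_le_of_norm_hasDerivWithin_le
    (fun r _ => (G.dirichletSemigroup_hasDerivAt (Finset.singleton_subset_iff.1 hW) f
      r).hasDerivWithinAt)
    (fun r hr => G.abs_laplacian_le (G.abs_dirichletSemigroup_le hf hr) x) hs ht

theorem heatSemigroup_continuousOn {f : V → ℝ} {C : ℝ} (hf : ∀ x, |f x| ≤ C) (x : V) :
    ContinuousOn (fun t => G.heatSemigroup t f x) (Ici 0) := by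
  set B := 1 / G.m x * ∑ y ∈ G.neighbors x, G.w x y * (2 * C)
  have : LipschitzOnWith B.toNNReal (fun t => G.heatSemigroup t f x) (Ici 0) := by
    refine LipschitzOnWith.of_dist_le_mul fun t ht s hs => ?_
    rw [Real.dist_eq, Real.dist_eq]
    refine (G.heatSemigroup_lipschitz hf x hs ht).trans ?_
    exact mul_le_mul_of_nonneg_right (Real.le_coe_toNNReal B) (abs_nonneg _)
  exact this.continuousOn

theorem laplacian_continuousOn {u : ℝ → V → ℝ} {s : Set ℝ}
    (h : ∀ x, ContinuousOn (fun t => u t x) s) (x : V) :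
    ContinuousOn (fun t => G.laplacian (u t) x) s := fun t ht =>
  G.laplacian_tendsto (fun y => h y t ht) x

theorem gamma_continuousOn {u : ℝ → V → ℝ} {s : Set ℝ}
    (h : ∀ x, ContinuousOn (fun t => u t x) s) (x : V) :
    ContinuousOn (fun t => G.gamma (u t) x) s := fun t ht =>
  G.gamma_tendsto (fun y => h y t ht) x

/-- The integrated heat equation survives the limit in $W$, where convergence of derivatives is not
known beforehand. Continuity of the integrand then recovers the differential form. -/
theorem heatSemigroup_eq_integral [Countable V] {f : V → ℝ} {C : ℝ} (hf : ∀ x, |f x| ≤ C) (x : V)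
    {t : ℝ} (ht : 0 ≤ t) : G.heatSemigroup t f x =
      f x + ∫ s in (0 : ℝ)..t, G.laplacian (G.heatSemigroup s f) x := by
  have hc : ∀ W : Finset V, Continuous fun s => G.laplacian (G.dirichletSemigroup W s f) x := by
    intro W
    rw [← continuousOn_univ]
    exact G.laplacian_continuousOn (fun y => (G.dirichletSemigroup_continuous f y).continuousOn) x
  have hlim : Tendsto (fun W => ∫ s in (0 : ℝ)..t, G.laplacian (G.dirichletSemigroup W s f) x) atTop
      (𝓝 (∫ s in (0 : ℝ)..t, G.laplacian (G.heatSemigroup s f) x)) := by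
    refine intervalIntegral.tendsto_integral_filter_of_dominated_convergence
      (fun _ => 1 / G.m x * ∑ y ∈ G.neighbors x, G.w x y * (2 * C))
      (Eventually.of_forall fun W => (hc W).aestronglyMeasurable)
      (Eventually.of_forall fun W => Eventually.of_forall fun s hs => ?_)
      intervalIntegrable_const (Eventually.of_forall fun s hs => ?_)
    · rw [uIoc_of_le ht] at hs
      exact G.abs_laplacian_le (G.abs_dirichletSemigroup_le hf hs.1.le) x
    · rw [uIoc_of_le ht] at hs
      exact G.laplacian_tendsto (G.heatSemigroup_tendsto hs.1.le hf) x
  refine tendsto_nhds_unique (G.heatSemigroup_tendsto ht hf x) ((hlim.const_add (f x)).congr' ?_)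
  filter_upwards [eventually_ge_atTop {x}] with W hW
  have hx : x ∈ W := Finset.singleton_subset_iff.1 hW
  rw [intervalIntegral.integral_eq_sub_of_hasDerivAt
    (fun s _ => G.dirichletSemigroup_hasDerivAt hx f s) ((hc W).intervalIntegrable _ _),
    G.dirichletSemigroup_zero hx]
  ring

theorem integral_hasDerivAt_of_continuousOn_Ici {F : ℝ → ℝ} (hF : ContinuousOn F (Ici 0)) {t : ℝ}
    (ht : 0 < t) : HasDerivAt (fun r => ∫ s in (0 : ℝ)..r, F s) (F t) t := by
  refine intervalIntegral.integral_hasDerivAt_right ?_ ?_ (hF.continuousAt (Ici_mem_nhds ht))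
  · refine (hF.mono ?_).intervalIntegrable
    rw [uIcc_of_le ht.le]
    exact Icc_subset_Ici_self
  · exact (hF.mono Ioi_subset_Ici_self).stronglyMeasurableAtFilter isOpen_Ioi t ht

theorem heatSemigroup_hasDerivAt [Countable V] {f : V → ℝ} {C : ℝ} (hf : ∀ x, |f x| ≤ C) {t : ℝ}
    (ht : 0 < t) (x : V) : HasDerivAt (fun s => G.heatSemigroup s f x)
      (G.laplacian (G.heatSemigroup t f) x) t := by
  have h := integral_hasDerivAt_of_continuousOn_Ici
    (G.laplacian_continuousOn (G.heatSemigroup_continuousOn hf) x) ht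
  refine (h.const_add (f x)).congr_of_eventuallyEq ?_
  filter_upwards [Ioi_mem_nhds ht] with s hs
  exact G.heatSemigroup_eq_integral hf x (mem_Ioi.1 hs).le

/-! ### Ingredients of the gradient estimate -/

theorem exists_abs_le_of_finite_support {f : V → ℝ} (hf : (Function.support f).Finite) :
    ∃ C, ∀ x, |f x| ≤ C := by
  refine ⟨∑ y ∈ hf.toFinset, |f y|, fun x => ?_⟩
  by_cases hx : x ∈ hf.toFinset
  · exact Finset.single_le_sum (f := fun y => |f y|) (fun y _ => abs_nonneg _) hx
  · have h0 : f x = 0 := by simpa using hx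
    rw [h0, abs_zero]
    exact Finset.sum_nonneg fun y _ => abs_nonneg _

theorem exists_sum_sq_le_of_finite_support {f : V → ℝ} (hf : (Function.support f).Finite) :
    ∃ M, ∀ S : Finset V, ∑ x ∈ S, G.m x * f x ^ 2 ≤ M := by
  classical
  have h0 : ∀ x, 0 ≤ G.m x * f x ^ 2 := fun x => mul_nonneg (G.m_pos x).le (sq_nonneg _)
  refine ⟨∑ y ∈ hf.toFinset, G.m y * f y ^ 2, fun S => ?_⟩
  calc _ ≤ ∑ x ∈ S ∪ hf.toFinset, G.m x * f x ^ 2 :=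
        Finset.sum_le_sum_of_subset_of_nonneg Finset.subset_union_left fun x _ _ => h0 x
    _ = _ := (Finset.sum_subset Finset.subset_union_right fun x _ hx => by
        have : f x = 0 := by simpa using hx
        simp [this]).symm

theorem laplacian_finite_support {f : V → ℝ} (hf : (Function.support f).Finite) :
    (Function.support (G.laplacian f)).Finite := by
  obtain ⟨S, hWS, hS⟩ := G.exists_hull hf.toFinset
  refine S.finite_toSet.subset fun x hx => ?_
  by_contra hxS
  refine hx ?_
  have h0 : ∀ y, y ∉ hf.toFinset → f y = 0 := fun y hy => by simpa using hy
  rw [laplacian, Finset.sum_eq_zero fun y hy => ?_, mul_zero]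
  rw [h0 x fun h => hxS (hWS h), h0 y fun h => hxS (hS y h ?_), sub_zero, mul_zero]
  rw [mem_neighbors, G.w_symm]
  exact G.mem_neighbors.1 hy

variable {G} in
theorem NonDegenerate.exists_le (h : G.NonDegenerate) : ∃ μ > 0, ∀ x, μ ≤ G.m x :=
  ⟨_, h, fun x => ciInf_le ⟨0, by rintro _ ⟨y, rfl⟩; exact (G.m_pos y).le⟩ x⟩

/-- With $m\ge\mu$, an $\ell^1$ bound gives $g\le M/\mu$ pointwise, hence an $\ell^2$ bound. This is
where non-degeneracy of $m$ enters. -/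
theorem sum_sq_le_of_sum_le {μ : ℝ} (hμ : 0 < μ) (hm : ∀ x, μ ≤ G.m x) {g : V → ℝ}
    (hg : ∀ x, 0 ≤ g x) {M : ℝ} (hM : ∀ S : Finset V, ∑ x ∈ S, G.m x * g x ≤ M) (S : Finset V) :
    ∑ x ∈ S, G.m x * g x ^ 2 ≤ M / μ * M := by
  have h1 : ∀ x, g x ≤ M / μ := by
    intro x
    rw [le_div_iff₀ hμ]
    have := hM {x}
    rw [Finset.sum_singleton] at this
    nlinarith [hm x, hg x]
  have hM0 : 0 ≤ M := by simpa using hM ∅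
  calc _ ≤ ∑ x ∈ S, M / μ * (G.m x * g x) := Finset.sum_le_sum fun x _ => by
        have := mul_le_mul_of_nonneg_right (h1 x) (mul_nonneg (G.m_pos x).le (hg x))
        linarith
    _ = M / μ * ∑ x ∈ S, G.m x * g x := by rw [Finset.mul_sum]
    _ ≤ _ := mul_le_mul_of_nonneg_left (hM S) (by positivity)

/-- The left side is $\partial_t\Gamma u$ along the heat flow, so this is the form in which
curvature enters the parabolic inequalities. -/
theorem two_mul_gammaBilin_laplacian_le {κ : ℝ} {N : ℝ≥0∞} {x : V} (h : G.CD κ N x) (u : V → ℝ) :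
    2 * G.gammaBilin u (G.laplacian u) x ≤ G.laplacian (G.gamma u) x - 2 * κ * G.gamma u x
      - 2 * (N⁻¹).toReal * G.laplacian u x ^ 2 := by
  have h1 := h u
  rw [gamma2, gamma2Bilin] at h1
  change _ ≤ 1 / 2 * (G.laplacian (G.gamma u) x - _ - _) at h1
  linarith

theorem laplacian_integral {F : ℝ → V → ℝ} {a b : ℝ}
    (hF : ∀ y, IntervalIntegrable (fun s => F s y) volume a b) (x : V) :
    G.laplacian (fun y => ∫ s in a..b, F s y) x = ∫ s in a..b, G.laplacian (F s) x := by
  simp only [laplacian]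
  rw [intervalIntegral.integral_const_mul, intervalIntegral.integral_finsetSum fun y _ =>
    ((hF y).sub (hF x)).const_mul _]
  congr 1
  refine Finset.sum_congr rfl fun y _ => ?_
  rw [intervalIntegral.integral_const_mul, intervalIntegral.integral_sub (hF y) (hF x)]

theorem exp_mul_heatSemigroup_continuousOn {h : V → ℝ} {C : ℝ} (hh : ∀ x, |h x| ≤ C) (a : ℝ)
    (x : V) : ContinuousOn (fun s => Real.exp (a * s) * G.heatSemigroup s h x) (Ici 0) :=
  (by fun_prop : Continuous fun s : ℝ => Real.exp (a * s)).continuousOn.mul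
    (G.heatSemigroup_continuousOn hh x)

theorem exp_mul_heatSemigroup_intervalIntegrable {h : V → ℝ} {C : ℝ} (hh : ∀ x, |h x| ≤ C) (a : ℝ)
    (x : V) {t : ℝ} (ht : 0 ≤ t) :
    IntervalIntegrable (fun s => Real.exp (a * s) * G.heatSemigroup s h x) volume 0 t := by
  refine ((G.exp_mul_heatSemigroup_continuousOn hh a x).mono ?_).intervalIntegrable
  rw [uIcc_of_le ht]
  exact Icc_subset_Ici_self

/-- Duhamel's formula: $J_t=\int_0^te^{as}P_sh\,ds$ solves $\partial_tJ=\Delta J+h+aJ$. Integrate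
the derivative of $e^{as}P_sh$. -/
theorem laplacian_integral_exp_mul_heatSemigroup [Countable V] {h : V → ℝ} {C : ℝ}
    (hh : ∀ x, |h x| ≤ C) (a : ℝ) {t : ℝ} (ht : 0 ≤ t) (x : V) :
    G.laplacian (fun y => ∫ s in (0 : ℝ)..t, Real.exp (a * s) * G.heatSemigroup s h y) x =
      Real.exp (a * t) * G.heatSemigroup t h x - h x
        - a * ∫ s in (0 : ℝ)..t, Real.exp (a * s) * G.heatSemigroup s h x := by
  have hI : Icc 0 t ⊆ Ici (0 : ℝ) := Icc_subset_Ici_self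
  have hint := G.exp_mul_heatSemigroup_intervalIntegrable hh a x ht
  have hL : ContinuousOn (fun s => G.laplacian
      (fun y => Real.exp (a * s) * G.heatSemigroup s h y) x) (Icc 0 t) :=
    (G.laplacian_continuousOn (G.exp_mul_heatSemigroup_continuousOn hh a) x).mono hI
  have hLi : IntervalIntegrable (fun s => G.laplacian
      (fun y => Real.exp (a * s) * G.heatSemigroup s h y) x) volume 0 t :=
    (hL.mono (uIcc_of_le ht).subset).intervalIntegrable
  have ftc := intervalIntegral.integral_eq_sub_of_hasDerivAt_of_le ht
    ((G.exp_mul_heatSemigroup_continuousOn hh a x).mono hI)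
    (f' := fun s => G.laplacian (fun y => Real.exp (a * s) * G.heatSemigroup s h y) x
      + a * (Real.exp (a * s) * G.heatSemigroup s h x)) (fun s hs => by
      have he : HasDerivAt (fun r : ℝ => Real.exp (a * r)) (Real.exp (a * s) * (a * 1)) s :=
        ((hasDerivAt_id s).const_mul a).exp
      refine (he.mul (G.heatSemigroup_hasDerivAt hh hs.1 x)).congr_deriv ?_
      rw [laplacian_const_mul]
      ring) (hLi.add (hint.const_mul a))
  rw [intervalIntegral.integral_add hLi (hint.const_mul a), intervalIntegral.integral_const_mul,
    mul_zero, Real.exp_zero, one_mul, G.heatSemigroup_zero hh] at ftc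
  rw [G.laplacian_integral fun y => G.exp_mul_heatSemigroup_intervalIntegrable hh a y ht]
  linarith

/-- Leibniz and Young. The free $\delta$ lets the factor of $A$ tend to $1$ as $\varepsilon\to0$,
which keeps the constant $\|\Gamma f\|_\infty$ sharp. -/
theorem gamma_mul_le {η f : V → ℝ} (h0 : ∀ x, 0 ≤ η x) (h1 : ∀ x, η x ≤ 1) {C A ε δ : ℝ}
    (hf : ∀ x, |f x| ≤ C) (hA : ∀ x, G.gamma f x ≤ A) (hε : ∀ x, G.gamma η x ≤ ε) (hδ : 0 < δ)
    (x : V) : G.gamma (fun y => η y * f y) x ≤ (1 + δ) * A + (1 + 1 / δ) * C ^ 2 * ε := by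
  have hm := G.m_pos x
  have key : G.gamma (fun y => η y * f y) x ≤
      (1 + δ) * G.gamma f x + (1 + 1 / δ) * C ^ 2 * G.gamma η x := by
    refine le_of_mul_le_mul_left ?_ hm
    rw [mul_add, mul_left_comm, mul_left_comm _ _ (G.gamma η x), G.m_mul_gamma f subset_rfl,
      G.m_mul_gamma η subset_rfl, G.m_mul_gamma _ subset_rfl]
    simp only [Finset.mul_sum, ← Finset.sum_add_distrib]
    refine Finset.sum_le_sum fun y _ => ?_
    have hw := G.w_nonneg x y
    have h2 : (η y * f y - η x * f x) ^ 2 ≤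
        (1 + δ) * (f y - f x) ^ 2 + (1 + 1 / δ) * C ^ 2 * (η y - η x) ^ 2 := by
      have h3 : η y * f y - η x * f x = η x * (f y - f x) + f y * (η y - η x) := by ring
      have h4 : (η x * (f y - f x)) ^ 2 ≤ (f y - f x) ^ 2 := by
        rw [mul_pow]
        exact mul_le_of_le_one_left (sq_nonneg _) (pow_le_one₀ (h0 x) (h1 x))
      have h5 : (f y * (η y - η x)) ^ 2 ≤ C ^ 2 * (η y - η x) ^ 2 := by
        rw [mul_pow]
        exact mul_le_mul_of_nonneg_right (sq_le_sq' (abs_le.1 (hf y)).1 (abs_le.1 (hf y)).2)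
          (sq_nonneg _)
      have h6 : ∀ a b : ℝ, (a + b) ^ 2 ≤ (1 + δ) * a ^ 2 + (1 + 1 / δ) * b ^ 2 := by
        intro a b
        have : (1 + δ) * a ^ 2 + (1 + 1 / δ) * b ^ 2 - (a + b) ^ 2 = (δ * a - b) ^ 2 / δ := by
          field_simp
          ring
        have := div_nonneg (sq_nonneg (δ * a - b)) hδ.le
        linarith
      rw [h3]
      refine (h6 _ _).trans ?_
      have h7 := mul_le_mul_of_nonneg_left h4 (by positivity : 0 ≤ 1 + δ)
      have h8 := mul_le_mul_of_nonneg_left h5 (by positivity : 0 ≤ 1 + 1 / δ)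
      linarith
    have := mul_le_mul_of_nonneg_left h2 hw
    linarith
  refine key.trans (add_le_add (mul_le_mul_of_nonneg_left (hA x) (by positivity))
    (mul_le_mul_of_nonneg_left (hε x) (by positivity)))

variable {G}

namespace IsCutoff

variable {η : ℕ → V → ℝ} (hη : G.IsCutoff η)
include hη

/-! ### Gradient estimates for finitely supported functions -/

/-- The energy is controlled by the $\ell^2$ norms of $P_tf$ and $\Delta P_tf=P_t\Delta f$, both
bounded by their values at time $0$. -/
theorem exists_sum_gamma_heatSemigroup_sq_le (hm : G.NonDegenerate) {f : V → ℝ}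
    (hf : (Function.support f).Finite) :
    ∃ M, ∀ t, 0 ≤ t → ∀ S : Finset V, ∑ x ∈ S, G.m x * G.gamma (G.heatSemigroup t f) x ^ 2 ≤ M := by
  obtain ⟨μ, hμ, hm⟩ := hm.exists_le
  obtain ⟨C, hC⟩ := exists_abs_le_of_finite_support hf
  obtain ⟨C', hC'⟩ := exists_abs_le_of_finite_support (G.laplacian_finite_support hf)
  obtain ⟨M, hM⟩ := G.exists_sum_sq_le_of_finite_support hf
  obtain ⟨M', hM'⟩ := G.exists_sum_sq_le_of_finite_support (G.laplacian_finite_support hf)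
  refine ⟨(2 * M + M') / μ * (2 * M + M'), fun t ht =>
    G.sum_sq_le_of_sum_le hμ hm (G.gamma_nonneg _)
      (hη.sum_gamma_le (G.sum_heatSemigroup_sq_le ht hC hM) fun S => ?_)⟩
  simp only [G.laplacian_heatSemigroup ht hf hC hC']
  exact G.sum_heatSemigroup_sq_le ht hC' hM' S

/-- Comparison for $e^{-2K_0s}\Gamma P_sf-A$. This crude bound controls the curvature defect on
$V_0$. -/
theorem gamma_heatSemigroup_le (hm : G.NonDegenerate) {N : ℝ≥0∞} {K₀ A : ℝ} (hK₀ : 0 ≤ K₀)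
    (hCD₀ : ∀ x, G.CD (-K₀) N x) {f : V → ℝ} (hf : (Function.support f).Finite)
    (hA : ∀ x, G.gamma f x ≤ A) {t : ℝ} (ht : 0 ≤ t) (x : V) :
    G.gamma (G.heatSemigroup t f) x ≤ Real.exp (2 * K₀ * t) * A := by
  have := hη.countable
  have hA0 : 0 ≤ A := (G.gamma_nonneg f x).trans (hA x)
  obtain ⟨C, hC⟩ := exists_abs_le_of_finite_support hf
  obtain ⟨M, hM⟩ := hη.exists_sum_gamma_heatSemigroup_sq_le hm hf
  have key : Real.exp (-2 * K₀ * t) * G.gamma (G.heatSemigroup t f) x - A ≤ 0 := by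
    refine hη.nonpos_of_subsolution ht (M := M)
      (g := fun s y => Real.exp (-2 * K₀ * s) * G.gamma (G.heatSemigroup s f) y - A)
      (g' := fun s y => Real.exp (-2 * K₀ * s) * (-2 * K₀ * 1) * G.gamma (G.heatSemigroup s f) y
        + Real.exp (-2 * K₀ * s) * (2 * G.gammaBilin (G.heatSemigroup s f)
          (G.laplacian (G.heatSemigroup s f)) y)) (fun y => ?_) (fun y s hs => ?_)
      (fun y s hs _ => ?_) (fun y => ?_) (fun s hs S => ?_) x
    · refine ContinuousOn.sub (ContinuousOn.mul (by fun_prop) ?_) continuousOn_const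
      exact (G.gamma_continuousOn (G.heatSemigroup_continuousOn hC) y).mono Icc_subset_Ici_self
    · exact ((((hasDerivAt_id s).const_mul (-2 * K₀)).exp).mul
        (G.gamma_hasDerivAt (G.heatSemigroup_hasDerivAt hC hs.1) y)).sub_const A
    · rw [laplacian_sub_const, laplacian_const_mul]
      have h1 := G.two_mul_gammaBilin_laplacian_le (hCD₀ y) (G.heatSemigroup s f)
      have h2 : 0 ≤ 2 * (N⁻¹).toReal * G.laplacian (G.heatSemigroup s f) y ^ 2 := by positivity
      have h3 := mul_le_mul_of_nonneg_left (h1.trans (sub_le_self _ h2))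
        (Real.exp_pos (-2 * K₀ * s)).le
      simp only [mul_one]
      linarith
    · have : G.heatSemigroup 0 f = f := funext fun z => G.heatSemigroup_zero hC z
      simpa [this] using hA y
    -- Constants need not lie in $\ell^2$, but subtracting $A\ge0$ only lowers the positive part,
    -- which $\Gamma P_sf$ dominates.
    · refine le_trans (Finset.sum_le_sum fun y _ => ?_) (hM s hs.1.le S)
      refine mul_le_mul_of_nonneg_left (pow_le_pow_left₀ (le_max_right _ _) ?_ 2) (G.m_pos y).le
      have h1 := G.gamma_nonneg (G.heatSemigroup s f) y
      have h2 : Real.exp (-2 * K₀ * s) ≤ 1 := Real.exp_le_one_iff.2 (by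
        have := mul_nonneg hK₀ hs.1.le
        linarith)
      exact max_le ((sub_le_self _ hA0).trans (mul_le_of_le_one_left h1 h2)) h1
  have h1 : Real.exp (2 * K₀ * t) * Real.exp (-2 * K₀ * t) = 1 := by
    rw [← Real.exp_add, ← Real.exp_zero]
    congr 1
    ring
  have h2 := mul_le_mul_of_nonneg_left (sub_nonpos.1 key) (Real.exp_pos (2 * K₀ * t)).le
  rwa [← mul_assoc, h1, one_mul] at h2

/-- The gradient estimate for finitely supported functions. -/
theorem gamma_heatSemigroup_le_of_finite_support (hm : G.NonDegenerate) {N : ℝ≥0∞} {K K₀ A : ℝ}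
    (hK : 0 < K) (hK₀ : 0 ≤ K₀) (hCD₀ : ∀ x, G.CD (-K₀) N x) {V₀ : Set V}
    (hCD : ∀ x ∉ V₀, G.CD K N x) {f : V → ℝ} (hf : (Function.support f).Finite)
    (hA : ∀ x, G.gamma f x ≤ A) {T : ℝ} (hT : 0 ≤ T) (x : V) :
    G.gamma (G.heatSemigroup T f) x ≤
      Real.exp (-2 * K * T) * G.heatSemigroup T (G.gamma f) x
        - (1 - Real.exp (-2 * K * T)) / K * (N⁻¹).toReal
          * (G.laplacian (G.heatSemigroup T f) x) ^ 2
        + 2 * (K₀ + K) * A * Real.exp (2 * K₀ * T)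
          * ∫ s in (0 : ℝ)..T, Real.exp (-2 * (K + K₀) * s) *
              G.heatSemigroup s (V₀.indicator fun _ => 1) x := by
  have := hη.countable
  have hA0 : 0 ≤ A := (G.gamma_nonneg f x).trans (hA x)
  have hΔ := G.laplacian_finite_support hf
  obtain ⟨μ, hμ, hμm⟩ := hm.exists_le
  obtain ⟨C, hC⟩ := exists_abs_le_of_finite_support hf
  obtain ⟨C', hC'⟩ := exists_abs_le_of_finite_support hΔ
  obtain ⟨M, hM⟩ := hη.exists_sum_gamma_heatSemigroup_sq_le hm hf
  obtain ⟨M', hM'⟩ := G.exists_sum_sq_le_of_finite_support hΔ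
  have hΓ : ∀ y, |G.gamma f y| ≤ A := fun y => by
    rw [abs_of_nonneg (G.gamma_nonneg f y)]
    exact hA y
  set q : V → ℝ := V₀.indicator fun _ => 1 with hq
  have hq0 : ∀ y, 0 ≤ q y := fun y => indicator_nonneg (fun _ _ => zero_le_one) y
  have hq1 : ∀ y, |q y| ≤ 1 := fun y => by
    rw [abs_of_nonneg (hq0 y)]
    exact indicator_le_self' (fun _ _ => zero_le_one) y
  set ν := (N⁻¹).toReal with hν
  have hν0 : 0 ≤ ν := ENNReal.toReal_nonneg
  -- Chosen so that $e^{2K_0s}J_s$ has total damping $a+2K_0=-2K$, the rate of the other terms.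
  set a := -2 * (K + K₀) with ha
  set E : ℝ → ℝ := fun s => Real.exp (-2 * K * s) with hE
  set E₀ : ℝ → ℝ := fun s => Real.exp (2 * K₀ * s) with hE₀
  set L := 2 * (K₀ + K) * A with hL
  have hL0 : 0 ≤ L := by positivity
  set b : ℝ → ℝ := fun s => (1 - E s) / K * ν with hb
  set v : ℝ → V → ℝ := fun s => G.heatSemigroup s (G.laplacian f) with hv
  set J : ℝ → V → ℝ := fun t y =>
    ∫ s in (0 : ℝ)..t, Real.exp (a * s) * G.heatSemigroup s q y with hJ
  have hvu : ∀ s, 0 ≤ s → G.laplacian (G.heatSemigroup s f) = v s := fun s hs =>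
    funext fun y => G.laplacian_heatSemigroup hs hf hC hC' y
  have hE1 : ∀ s, 0 ≤ s → E s ≤ 1 := fun s hs => Real.exp_le_one_iff.2 (by
    have := mul_nonneg hK.le hs
    linarith)
  have hb0 : ∀ s, 0 ≤ s → 0 ≤ b s := fun s hs =>
    mul_nonneg (div_nonneg (sub_nonneg.2 (hE1 s hs)) hK.le) hν0
  have hb1 : ∀ s, b s ≤ 1 / K * ν := fun s => by
    refine mul_le_mul_of_nonneg_right (div_le_div_of_nonneg_right ?_ hK.le) hν0
    linarith [Real.exp_pos (-2 * K * s)]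
  have hJ0 : ∀ s, 0 ≤ s → ∀ y, 0 ≤ J s y := fun s hs y =>
    intervalIntegral.integral_nonneg hs fun r hr =>
      mul_nonneg (Real.exp_pos _).le (G.heatSemigroup_nonneg hr.1 hq0 y)
  have hJc : ∀ y, ContinuousOn (fun s => J s y) (Icc 0 T) := fun y => by
    have := intervalIntegral.continuousOn_primitive_interval
      (((G.exp_mul_heatSemigroup_continuousOn hq1 a y).mono
        (Icc_subset_Ici_self : Icc 0 T ⊆ Ici (0 : ℝ))).integrableOn_Icc (μ := volume) |>.mono_set
          (uIcc_of_le hT).subset)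
    rwa [uIcc_of_le hT] at this
  have hEd : ∀ s, HasDerivAt E (E s * (-2 * K * 1)) s := fun s =>
    ((hasDerivAt_id s).const_mul (-2 * K)).exp
  have hE₀d : ∀ s, HasDerivAt E₀ (E₀ s * (2 * K₀ * 1)) s := fun s =>
    ((hasDerivAt_id s).const_mul (2 * K₀)).exp
  have hEc : Continuous E := continuous_iff_continuousAt.2 fun s => (hEd s).continuousAt
  have hE₀c : Continuous E₀ := continuous_iff_continuousAt.2 fun s => (hE₀d s).continuousAt
  have hIcc : Icc 0 T ⊆ Ici (0 : ℝ) := Icc_subset_Ici_self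
  have key : G.gamma (G.heatSemigroup T f) x + (-E T * G.heatSemigroup T (G.gamma f) x
      + (b T * v T x ^ 2 + -(L * E₀ T) * J T x)) ≤ 0 := by
    refine hη.nonpos_of_subsolution hT
      (g := fun s y => G.gamma (G.heatSemigroup s f) y
        + (-E s * G.heatSemigroup s (G.gamma f) y + (b s * v s y ^ 2 + -(L * E₀ s) * J s y)))
      (g' := fun s y => 2 * G.gammaBilin (G.heatSemigroup s f) (v s) y
        + ((-(E s * (-2 * K * 1)) * G.heatSemigroup s (G.gamma f) y
            + -E s * G.laplacian (G.heatSemigroup s (G.gamma f)) y)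
          + ((-(E s * (-2 * K * 1)) / K * ν * v s y ^ 2
              + b s * (↑2 * v s y ^ (2 - 1) * G.laplacian (v s) y))
            + (-(L * (E₀ s * (2 * K₀ * 1))) * J s y
              + -(L * E₀ s) * (Real.exp (a * s) * G.heatSemigroup s q y)))))
      (M := 2 * M + 2 * (1 / K * ν) ^ 2 * (M' / μ * M'))
      (fun y => ?_) (fun y s hs => ?_) (fun y s hs hpos => ?_) (fun y => ?_) (fun s hs S => ?_) x
    · have h1 := (G.gamma_continuousOn (G.heatSemigroup_continuousOn hC) y).mono hIcc
      have h2 := (G.heatSemigroup_continuousOn hΓ y).mono hIcc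
      have h3 := (G.heatSemigroup_continuousOn hC' y).mono hIcc
      have h4 : Continuous b := ((continuous_const.sub hEc).div_const K).mul continuous_const
      exact h1.add ((hEc.neg.continuousOn.mul h2).add ((h4.continuousOn.mul (h3.pow 2)).add
        ((continuous_const.mul hE₀c).neg.continuousOn.mul (hJc y))))
    · have h1 := G.gamma_hasDerivAt (G.heatSemigroup_hasDerivAt hC hs.1) y
      rw [hvu s hs.1.le] at h1
      have h2 := (hEd s).neg.mul (G.heatSemigroup_hasDerivAt hΓ hs.1 y)
      have h3 := ((((hEd s).const_sub 1).div_const K).mul_const ν).mul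
        ((G.heatSemigroup_hasDerivAt hC' hs.1 y).pow 2)
      have h4 := ((hE₀d s).const_mul L).neg.mul (integral_hasDerivAt_of_continuousOn_Ici
        (G.exp_mul_heatSemigroup_continuousOn hq1 a y) hs.1)
      exact h1.add (h2.add (h3.add h4))
    · have hs0 := hs.1.le
      rw [laplacian_add, laplacian_add, laplacian_add, laplacian_const_mul, laplacian_const_mul,
        laplacian_const_mul, laplacian_sq,
        G.laplacian_integral_exp_mul_heatSemigroup hq1 a hs0 y]
      change 0 < _ + (_ + (_ + _ * J s y)) at hpos
      change _ ≤ _ + (_ + (_ + _ * (_ - a * J s y)))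
      -- That is, $b'=2\nu-2Kb$: the $2\nu$ cancels the dimension term of the curvature inequality,
      -- the rest is damping at rate $2K$.
      have hb' : -(E s * (-2 * K * 1)) / K * ν = 2 * ν - 2 * K * b s := by
        simp only [hb]
        field_simp
        ring
      rw [hb']
      have hE₀0 : 0 ≤ E₀ s := (Real.exp_pos _).le
      have hG := G.gamma_nonneg (G.heatSemigroup s f) y
      have hbv := mul_nonneg (hb0 s hs0) (G.gamma_nonneg (v s) y)
      have hcurv : 2 * G.gammaBilin (G.heatSemigroup s f) (v s) y ≤
          G.laplacian (G.gamma (G.heatSemigroup s f)) y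
            - 2 * K * G.gamma (G.heatSemigroup s f) y - 2 * ν * v s y ^ 2 + L * E₀ s * q y := by
        by_cases hy : y ∈ V₀
        · have h1 := G.two_mul_gammaBilin_laplacian_le (hCD₀ y) (G.heatSemigroup s f)
          have h2 := hη.gamma_heatSemigroup_le hm hK₀ hCD₀ hf hA hs0 y
          have h3 := mul_le_mul_of_nonneg_left h2 (by positivity : 0 ≤ 2 * (K₀ + K))
          have h4 : q y = 1 := indicator_of_mem hy _
          rw [hvu s hs0] at h1
          rw [h4, hL]
          linarith
        · have h1 := G.two_mul_gammaBilin_laplacian_le (hCD y hy) (G.heatSemigroup s f)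
          have h4 : q y = 0 := indicator_of_notMem hy _
          rw [hvu s hs0] at h1
          rw [h4]
          linarith
      -- The terms combine to $\partial_sF\le\Delta F-2KF$; at a point with $F>0$ the last term can
      -- be dropped.
      have h2K := mul_pos (mul_pos two_pos hK) hpos
      have haJ : L * E₀ s * (a * J s y) =
          -(2 * K * (L * E₀ s * J s y)) - 2 * K₀ * (L * E₀ s * J s y) := by
        rw [ha]
        ring
      simp only [Nat.add_one_sub_one, pow_one]
      linarith
    · have h1 : G.heatSemigroup 0 f = f := funext fun z => G.heatSemigroup_zero hC z
      simp [h1, G.heatSemigroup_zero hΓ, hE, hb, hJ]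
    · have hs0 := hs.1.le
      have h1 := hM s hs0 S
      -- The $\ell^2$ bound on $v$ is an $\ell^1$ bound on $v^2$, so $v^2$ is bounded in $\ell^2$.
      have h2 := G.sum_sq_le_of_sum_le hμ hμm (g := fun y => v s y ^ 2) (fun y => sq_nonneg _)
        (G.sum_heatSemigroup_sq_le hs0 hC' hM') S
      have h3 := mul_le_mul_of_nonneg_left h2 (by positivity : 0 ≤ 2 * (1 / K * ν) ^ 2)
      refine le_trans ?_ (add_le_add (mul_le_mul_of_nonneg_left h1 zero_le_two) h3)
      rw [Finset.mul_sum, Finset.mul_sum, ← Finset.sum_add_distrib]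
      refine Finset.sum_le_sum fun y _ => ?_
      have hG := G.gamma_nonneg (G.heatSemigroup s f) y
      have h4 := mul_le_mul_of_nonneg_right (hb1 s) (sq_nonneg (v s y))
      have h5 : 0 ≤ E s * G.heatSemigroup s (G.gamma f) y :=
        mul_nonneg (Real.exp_pos _).le (G.heatSemigroup_nonneg hs0 (G.gamma_nonneg f) y)
      have h6 : 0 ≤ L * E₀ s * J s y :=
        mul_nonneg (mul_nonneg hL0 (Real.exp_pos _).le) (hJ0 s hs0 y)
      have h7 : 0 ≤ 1 / K * ν * v s y ^ 2 := by positivity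
      have h8 : max (G.gamma (G.heatSemigroup s f) y + (-E s * G.heatSemigroup s (G.gamma f) y
          + (b s * v s y ^ 2 + -(L * E₀ s) * J s y))) 0 ≤
            G.gamma (G.heatSemigroup s f) y + 1 / K * ν * v s y ^ 2 :=
        max_le (by linarith) (by linarith)
      have h9 := pow_le_pow_left₀ (le_max_right _ _) h8 2
      have h10 : (G.gamma (G.heatSemigroup s f) y + 1 / K * ν * v s y ^ 2) ^ 2 ≤
          2 * G.gamma (G.heatSemigroup s f) y ^ 2 + 2 * (1 / K * ν) ^ 2 * (v s y ^ 2) ^ 2 := by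
        nlinarith [sq_nonneg (G.gamma (G.heatSemigroup s f) y - 1 / K * ν * v s y ^ 2)]
      have h11 := mul_le_mul_of_nonneg_left (h9.trans h10) (G.m_pos y).le
      linarith
  rw [hvu T hT]
  linarith

end IsCutoff

end WeightedGraph

/-! ### From finitely supported to bounded functions -/

open WeightedGraph Filter Topology in
theorem mainTheorem3 {V : Type*} (G : WeightedGraph V) (hcomplete : G.IsComplete)
    (hm : G.NonDegenerate) (N : ℝ≥0∞) (hN : 0 < N) (K K₀ : ℝ) (hK : 0 < K) (hK₀ : 0 ≤ K₀)
    (hCD₀ : ∀ x, G.CD (-K₀) N x)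
    (hCD : ∀ x, x ∉ G.nonposCurvatureSet N → G.CD K N x)
    (f : V → ℝ) (hf : ∃ C : ℝ, ∀ x, |f x| ≤ C) (hΓf : ∃ C : ℝ, ∀ x, |G.gamma f x| ≤ C)
    (T : ℝ) (hT : 0 ≤ T) (x : V) :
    Summable (fun y => G.heatKernel T x y * f y) ∧
    Summable (fun y => G.heatKernel T x y * G.gamma f y) ∧
    (∀ s ∈ Set.Icc (0 : ℝ) T, Summable
      (fun y => G.heatKernel s x y * (G.nonposCurvatureSet N).indicator (fun _ => (1 : ℝ)) y)) ∧
    IntervalIntegrable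
      (fun s => Real.exp (-2 * (K + K₀) * s) *
        G.heatSemigroup s ((G.nonposCurvatureSet N).indicator fun _ => 1) x)
      MeasureTheory.volume 0 T ∧
    G.gamma (G.heatSemigroup T f) x ≤
      Real.exp (-2 * K * T) * G.heatSemigroup T (G.gamma f) x
        - (1 - Real.exp (-2 * K * T)) / K * (N⁻¹).toReal
          * (G.laplacian (G.heatSemigroup T f) x) ^ 2
        + 2 * (K₀ + K) * (⨆ y, |G.gamma f y|) * Real.exp (2 * K₀ * T)
          * ∫ s in (0 : ℝ)..T, Real.exp (-2 * (K + K₀) * s) *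
              G.heatSemigroup s ((G.nonposCurvatureSet N).indicator fun _ => 1) x := by
  obtain ⟨C, hC⟩ := hf
  obtain ⟨A₀, hA₀⟩ := hΓf
  have hq1 : ∀ y, |(G.nonposCurvatureSet N).indicator (fun _ => (1 : ℝ)) y| ≤ 1 := fun y => by
    by_cases hy : y ∈ G.nonposCurvatureSet N <;> simp [hy]
  refine ⟨G.heatKernel_mul_summable hT x hC, G.heatKernel_mul_summable hT x hA₀,
    fun s hs => G.heatKernel_mul_summable hs.1 x hq1,
    G.exp_mul_heatSemigroup_intervalIntegrable hq1 _ x hT, ?_⟩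
  obtain ⟨η, hη⟩ := hcomplete.exists_isCutoff
  set A := ⨆ y, |G.gamma f y| with hAdef
  have hA : ∀ y, G.gamma f y ≤ A := fun y => (le_abs_self _).trans
    (le_ciSup (f := fun y => |G.gamma f y|) ⟨A₀, by rintro _ ⟨z, rfl⟩; exact hA₀ z⟩ y)
  have hA0 : 0 ≤ A := (G.gamma_nonneg f x).trans (hA x)
  have hC0 : 0 ≤ C := (abs_nonneg _).trans (hC x)
  -- With $\delta_k^2=1/(k+1)$, the bound for $\Gamma\eta_k$, both $\delta_k$ and the Young
  -- remainder $(1+1/\delta_k)\delta_k^2=\delta_k^2+\delta_k$ tend to $0$.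
  set δ : ℕ → ℝ := fun k => Real.sqrt (1 / ((k : ℝ) + 1)) with hδ
  have hδ0 : ∀ k, 0 < δ k := fun k => Real.sqrt_pos.2 (by positivity)
  have hδ2 : ∀ k, δ k ^ 2 = 1 / ((k : ℝ) + 1) := fun k => Real.sq_sqrt (by positivity)
  have hδ1 : ∀ k, δ k ≤ 1 := fun k => Real.sqrt_le_one.2 (by
    rw [div_le_one (by positivity)]
    linarith [k.cast_nonneg (α := ℝ)])
  have hδt : Tendsto δ atTop (𝓝 0) := by
    have := (tendsto_one_div_add_atTop_nhds_zero_nat (𝕜 := ℝ)).sqrt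
    rwa [Real.sqrt_zero] at this
  set A' : ℕ → ℝ := fun k => (1 + δ k) * A + (δ k ^ 2 + δ k) * C ^ 2 with hA'
  have hΓk : ∀ k y, G.gamma (fun z => η k z * f z) y ≤ A' k := fun k y => by
    refine (G.gamma_mul_le (hη.nonneg k) (hη.le_one k) hC hA (hη.gamma_le k) (hδ0 k) y).trans_eq ?_
    rw [← hδ2, hA']
    have := (hδ0 k).ne'
    field_simp
  have hA't : Tendsto A' atTop (𝓝 A) := by
    have : Tendsto A' atTop (𝓝 ((1 + 0) * A + (0 ^ 2 + 0) * C ^ 2)) :=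
      ((hδt.const_add 1).mul_const A).add (((hδt.pow 2).add hδt).mul_const _)
    simpa using this
  -- A bound uniform in $k$, needed for dominated convergence of $P_T\Gamma(\eta_kf)$.
  have hΓk' : ∀ k y, |G.gamma (fun z => η k z * f z) y| ≤ 2 * A + 2 * C ^ 2 := fun k y => by
    rw [abs_of_nonneg (G.gamma_nonneg _ y)]
    refine (hΓk k y).trans ?_
    have h1 := hδ1 k
    have h2 : δ k ^ 2 ≤ 1 := pow_le_one₀ (hδ0 k).le h1
    exact add_le_add (mul_le_mul_of_nonneg_right (by linarith) hA0)
      (mul_le_mul_of_nonneg_right (by linarith) (sq_nonneg C))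
  have hfk : ∀ y, Tendsto (fun k => η k y * f y) atTop (𝓝 (f y)) := fun y => by
    simpa using (hη.tendsto y).mul_const (f y)
  have hCk : ∀ k y, |η k y * f y| ≤ C := fun k y => by
    rw [abs_mul, abs_of_nonneg (hη.nonneg k y)]
    exact (mul_le_of_le_one_left (abs_nonneg _) (hη.le_one k y)).trans (hC y)
  have hP := G.heatSemigroup_tendsto_of_dominated hT hCk hfk
  have hPΓ := G.heatSemigroup_tendsto_of_dominated hT hΓk' (G.gamma_tendsto hfk) x
  refine le_of_tendsto_of_tendsto' (G.gamma_tendsto hP x)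
    (((hPΓ.const_mul (Real.exp (-2 * K * T))).sub (((G.laplacian_tendsto hP x).pow 2).const_mul
      ((1 - Real.exp (-2 * K * T)) / K * (N⁻¹).toReal))).add
      (((hA't.const_mul (2 * (K₀ + K))).mul_const (Real.exp (2 * K₀ * T))).mul_const
        (∫ s in (0 : ℝ)..T, Real.exp (-2 * (K + K₀) * s) *
          G.heatSemigroup s ((G.nonposCurvatureSet N).indicator fun _ => 1) x))) fun k => ?_
  exact hη.gamma_heatSemigroup_le_of_finite_support hm hK hK₀ hCD₀ hCD
    ((hη.finite_support k).subset (Function.support_mul_subset_left _ _)) (hΓk k) hT x
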